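/- Let $n\ge 0$, let $A=\mathbb{C}[t_1^{\pm1},\dots,t_n^{\pm1}]$, and let $\mathcal{W}_n=\mathrm{Der}_{\mathbb{C}}(A)$ be the Witt algebra, with basis $t^kd_i$ ($k\in\mathbb{Z}^n$, $1\le i\le n$), where $d_i=t_i\,\partial/\partial t_i$. Put $D=\bigoplus_{i=1}^n\mathbb{C}d_i$, let $Z$ be a finite-dimensional abelian complex Lie algebra, and let $\mathcal{W}_n\oplus Z$ be the direct sum of Lie algebras, with its subalgebra $D\oplus Z$. For $\Lambda=(\lambda_1,\dots,\lambda_n)\in(\mathbb{C}^*)^n$ and $a\in U(Z)$ let $\Omega(\Lambda,a)$ be the $(\mathcal{W}_n\oplus Z)$-module with underlying space the polynomial algebra $U(Z)[d_1,\dots,d_n]$ on which $z\in Z$ acts by multiplication by $z\in U(Z)$ and $$t^kd_i\cdot f(d_1,\dots,d_n)=\lambda_1^{k_1}\cdots\lambda_n^{k_n}\,\bigl(d_i-k_i(a+1)\bigr)\,f(d_1-k_1,\dots,d_n-k_n).$$ Let $M$ be a $U(\mathcal{W}_n\oplus Z)$-module whose restriction to $U(D\oplus Z)$ is isomorphic to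 the left regular module $U(D\oplus Z)$. Then there are $\Lambda\in(\mathbb{C}^*)^n$ and $a\in U(Z)$ such that $M\cong\Omega(\Lambda,a)$ as $U(\mathcal{W}_n\oplus Z)$-modules. -/

import Mathlib

open scoped BigOperators

noncomputable section

namespace WittAlgebra

attribute [local instance 100] LieRing.ofAssociativeRing

/-- The universal enveloping algebra of a complex Lie algebra. -/
abbrev U (L : Type*) [LieRing L] [LieAlgebra ℂ L] : Type _ := UniversalEnvelopingAlgebra ℂ L

/-- The inclusion `U(𝔟) → U(𝔞)` induced by the inclusion of a Lie subalgebra `𝔟 ⊆ 𝔞`. -/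
def resHom {𝔞 : Type*} [LieRing 𝔞] [LieAlgebra ℂ 𝔞] (𝔟 : LieSubalgebra ℂ 𝔞) : U 𝔟 →ₐ[ℂ] U 𝔞 :=
  UniversalEnvelopingAlgebra.lift ℂ ((UniversalEnvelopingAlgebra.ι ℂ).comp 𝔟.incl)

/-- The `U(𝔞)`-module `M` restricts to a free `U(𝔟)`-module of rank one, that is,
its restriction to `U(𝔟)` is isomorphic to the left regular module `U(𝔟)`. -/
def IsFreeOfRankOne {𝔞 : Type*} [LieRing 𝔞] [LieAlgebra ℂ 𝔞] (𝔟 : LieSubalgebra ℂ 𝔞)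
    (M : Type*) [AddCommGroup M] [Module (U 𝔞) M] : Prop :=
  letI : Module (U 𝔟) M := Module.compHom M (resHom 𝔟).toRingHom
  Nonempty (M ≃ₗ[U 𝔟] U 𝔟)

section Witt

variable (n : ℕ)

/-- The algebra `A = ℂ[t₁^{±1}, …, tₙ^{±1}]` of Laurent polynomials in `n` variables. -/
abbrev Laurent : Type := AddMonoidAlgebra ℂ (Fin n → ℤ)

/-- The Witt algebra `Wₙ = Der(A)`. -/
abbrev Witt : Type := Derivation ℂ (Laurent n) (Laurent n)

variable {n}

/-- The monomial `t^k`. -/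
def mono (k : Fin n → ℤ) : Laurent n := AddMonoidAlgebra.single k 1

/-- The linear map `A → V` sending `t^k` to `v k`. -/
def ofMono {V : Type*} [AddCommGroup V] [Module ℂ V] (v : (Fin n → ℤ) → V) : Laurent n →ₗ[ℂ] V :=
  Finsupp.linearCombination ℂ v ∘ₗ (AddMonoidAlgebra.coeffLinearEquiv ℂ).toLinearMap

lemma ofMono_mono {V : Type*} [AddCommGroup V] [Module ℂ V] (v : (Fin n → ℤ) → V)
    (k : Fin n → ℤ) : ofMono v (mono k) = v k := by
  simp [ofMono, mono]

lemma mono_add (k l : Fin n → ℤ) : mono (k + l) = mono k * mono l := by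
  simp [mono, AddMonoidAlgebra.single_mul_single]

lemma mono_zero : mono (0 : Fin n → ℤ) = 1 := rfl

lemma laurent_hom_ext {V : Type*} [AddCommGroup V] [Module ℂ V] {f g : Laurent n →ₗ[ℂ] V}
    (h : ∀ k, f (mono k) = g (mono k)) : f = g := by
  refine LinearMap.ext fun x => ?_
  induction x using AddMonoidAlgebra.induction_linear with
  | zero => simp
  | add x y hx hy => simp [hx, hy]
  | single k c =>
    have : (AddMonoidAlgebra.single k c : Laurent n) = c • mono k := by simp [mono]
    rw [this, map_smul, map_smul, h]

/-- The degree derivation `dᵢ = tᵢ ∂/∂tᵢ`, with `dᵢ(t^k) = kᵢ t^k`. -/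
def d (i : Fin n) : Witt n :=
  Derivation.mk' (ofMono fun k => (k i : ℂ) • mono k) (by
    intro x y
    have key : (LinearMap.mul ℂ (Laurent n)).compr₂ (ofMono fun k => (k i : ℂ) • mono k) =
        (LinearMap.mul ℂ (Laurent n)).compl₂ (ofMono fun k => (k i : ℂ) • mono k) +
        ((LinearMap.mul ℂ (Laurent n)).compl₂ (ofMono fun k => (k i : ℂ) • mono k)).flip := by
      refine laurent_hom_ext fun k => laurent_hom_ext fun l => ?_
      simp only [LinearMap.compr₂_apply, LinearMap.add_apply, LinearMap.compl₂_apply,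
        LinearMap.flip_apply, LinearMap.mul_apply', ← mono_add, ofMono_mono]
      rw [mul_smul_comm, mul_smul_comm, ← mono_add, ← mono_add, add_comm l k, ← add_smul]
      congr 1
      simp [add_comm]
    simpa using LinearMap.congr_fun₂ key x y)

lemma d_mono (i : Fin n) (k : Fin n → ℤ) : d i (mono k) = (k i : ℂ) • mono k :=
  ofMono_mono _ _

lemma deriv_ext {δ ε : Witt n} (h : ∀ k, δ (mono k) = ε (mono k)) : δ = ε := by
  have : (δ : Laurent n →ₗ[ℂ] Laurent n) = ε := laurent_hom_ext h
  exact Derivation.ext fun x => LinearMap.congr_fun this x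

/-- The bracket `[t^k dᵢ, t^l dⱼ] = lᵢ t^{k+l} dⱼ - kⱼ t^{k+l} dᵢ`. -/
lemma bracket_d (k l : Fin n → ℤ) (i j : Fin n) :
    ⁅mono k • d i, mono l • d j⁆ =
      (l i : ℂ) • (mono (k + l) • d j) - (k j : ℂ) • (mono (k + l) • d i) := by
  refine deriv_ext fun m => ?_
  simp only [Derivation.commutator_apply, Derivation.smul_apply, d_mono, Derivation.sub_apply,
    smul_eq_mul, mul_smul_comm, Derivation.map_smul, ← mono_add, Pi.add_apply, Int.cast_add]
  rw [← add_assoc, ← add_assoc, add_comm l k]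
  module

/-- The coefficient `cᵢ(δ) = tᵢ⁻¹ δ(tᵢ) ∈ A`, so that `δ = ∑ᵢ cᵢ(δ) dᵢ`. -/
def coef (i : Fin n) : Witt n →ₗ[ℂ] Laurent n where
  toFun δ := mono (-Pi.single i 1) * δ (mono (Pi.single i 1))
  map_add' _ _ := by simp [mul_add]
  map_smul' _ _ := by simp

lemma coef_smul_d (i j : Fin n) (f : Laurent n) :
    coef i (f • d j) = if i = j then f else 0 := by
  have h : mono (-Pi.single i 1) * mono (Pi.single i 1 : Fin n → ℤ) = 1 := by
    rw [← mono_add, neg_add_cancel, mono_zero]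
  simp only [coef, LinearMap.coe_mk, AddHom.coe_mk, Derivation.smul_apply, d_mono, smul_eq_mul,
    mul_smul_comm]
  rw [mul_left_comm, h]
  by_cases hij : i = j
  · subst hij; simp
  · simp [hij, Ne.symm hij]

/-- Every derivation of `A` is an `A`-combination of `d₁, …, dₙ`. -/
lemma eq_sum_coef (δ : Witt n) : δ = ∑ i, coef i δ • d i := by
  let φ : (Fin n → ℤ) →+ Laurent n :=
    { toFun := fun k => mono (-k) * δ (mono k)
      map_zero' := by simp [mono_zero]
      map_add' := by
        intro k l
        have h1 : ∀ k : Fin n → ℤ, mono (-k) * mono k = 1 := fun k => by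
          rw [← mono_add, neg_add_cancel, mono_zero]
        have hk := h1 k
        have hl := h1 l
        rw [neg_add, mono_add, mono_add, Derivation.leibniz]
        simp only [smul_eq_mul]
        linear_combination (mono (-l) * δ (mono l)) * hk + (mono (-k) * δ (mono k)) * hl }
  let ψ : (Fin n → ℤ) →+ Laurent n :=
    { toFun := fun k => ∑ i, (k i : ℂ) • coef i δ
      map_zero' := by simp
      map_add' := by intro k l; simp [add_smul, Finset.sum_add_distrib] }
  have hφψ : φ = ψ := by
    refine AddMonoidHom.functions_ext' _ _ _ fun i => ?_
    refine AddMonoidHom.ext_int ?_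
    have : (ψ (Pi.single i 1) : Laurent n) = coef i δ := by
      show ∑ j, (((Pi.single i 1 : Fin n → ℤ) j : ℤ) : ℂ) • coef j δ = _
      rw [Finset.sum_eq_single i]
      · simp
      · intro j _ hj; simp [hj]
      · simp
    simp only [AddMonoidHom.comp_apply, AddMonoidHom.single_apply]
    rw [this]
    rfl
  refine deriv_ext fun k => ?_
  have hk : mono (-k) * δ (mono k) = ∑ i, (k i : ℂ) • coef i δ := DFunLike.congr_fun hφψ k
  have h1 : mono k * mono (-k) = (1 : Laurent n) := by
    rw [← mono_add, add_neg_cancel, mono_zero]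
  have : δ (mono k) = mono k * ∑ i, (k i : ℂ) • coef i δ := by
    rw [← hk, ← mul_assoc, h1, one_mul]
  have hsum : (∑ i, coef i δ • d i) (mono k) = ∑ i, (coef i δ • d i) (mono k) := by
    rw [← Derivation.coeFnAddMonoidHom_apply, map_sum, Finset.sum_apply]
    rfl
  rw [this, hsum, Finset.mul_sum]
  refine Finset.sum_congr rfl fun i _ => ?_
  rw [Derivation.smul_apply, d_mono, smul_eq_mul, mul_smul_comm, mul_smul_comm, mul_comm]

/-- Linear maps out of the Witt algebra agree as soon as they agree on all `t^k dᵢ`. -/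
lemma witt_hom_ext {V : Type*} [AddCommGroup V] [Module ℂ V] {f g : Witt n →ₗ[ℂ] V}
    (h : ∀ (k : Fin n → ℤ) (i : Fin n), f (mono k • d i) = g (mono k • d i)) : f = g := by
  have key : ∀ i, f ∘ₗ (LinearMap.toSpanSingleton (Laurent n) (Witt n) (d i)).restrictScalars ℂ =
      g ∘ₗ (LinearMap.toSpanSingleton (Laurent n) (Witt n) (d i)).restrictScalars ℂ := fun i =>
    laurent_hom_ext fun k => by simpa using h k i
  refine LinearMap.ext fun δ => ?_
  rw [eq_sum_coef δ, map_sum, map_sum]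
  exact Finset.sum_congr rfl fun i _ => by simpa using LinearMap.congr_fun (key i) (coef i δ)

variable (n)

/-- The subalgebra `D = ⨁ᵢ ℂ dᵢ` of the Witt algebra. -/
def D : LieSubalgebra ℂ (Witt n) :=
  { Submodule.span ℂ (Set.range (d : Fin n → Witt n)) with
    lie_mem' := by
      intro x y hx hy
      have hcomm : ∀ i j : Fin n, ⁅d i, d j⁆ = 0 := fun i j => by
        simpa [mono_zero] using bracket_d (0 : Fin n → ℤ) 0 i j
      have hx' : x ∈ Submodule.span ℂ (Set.range (d : Fin n → Witt n)) := hx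
      have hy' : y ∈ Submodule.span ℂ (Set.range (d : Fin n → Witt n)) := hy
      have h1 : ∀ i, ⁅d i, y⁆ = 0 := fun i => by
        have : Submodule.span ℂ (Set.range (d : Fin n → Witt n)) ≤
            LinearMap.ker (LieAlgebra.ad ℂ (Witt n) (d i)) :=
          Submodule.span_le.mpr (by rintro _ ⟨j, rfl⟩; exact hcomm i j)
        exact this hy'
      have h0 : ⁅y, x⁆ = 0 := by
        have : Submodule.span ℂ (Set.range (d : Fin n → Witt n)) ≤
            LinearMap.ker (LieAlgebra.ad ℂ (Witt n) y) :=
          Submodule.span_le.mpr (by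
            rintro _ ⟨j, rfl⟩
            show ⁅y, d j⁆ = 0
            rw [← lie_skew, h1, neg_zero])
        exact this hx'
      show ⁅x, y⁆ ∈ Submodule.span ℂ (Set.range (d : Fin n → Witt n))
      rw [← lie_skew, h0, neg_zero]
      exact Submodule.zero_mem _ }

variable (Z : Type*) [LieRing Z] [LieAlgebra ℂ Z]

/-- The subalgebra `D ⊕ Z` of the direct sum of Lie algebras `Wₙ ⊕ Z`. -/
def DZ : LieSubalgebra ℂ (Witt n × Z) := (D n).comap (LieHom.fst ℂ (Witt n) Z)

end Witt

section Omega

lemma subalgebra_eq_top {L : Type*} [LieRing L] [LieAlgebra ℂ L] (S : Subalgebra ℂ (U L))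
    (h : ∀ x : L, (UniversalEnvelopingAlgebra.ι ℂ x : U L) ∈ S) : S = ⊤ := by
  let f : L →ₗ⁅ℂ⁆ S :=
    { toFun := fun x => ⟨UniversalEnvelopingAlgebra.ι ℂ x, h x⟩
      map_add' := fun x y => Subtype.ext (map_add _ x y)
      map_smul' := fun c x => Subtype.ext (map_smul _ c x)
      map_lie' := fun {x y} => Subtype.ext (LieHom.map_lie _ x y) }
  have hid : S.val.comp (UniversalEnvelopingAlgebra.lift ℂ f) = AlgHom.id ℂ (U L) := by
    refine UniversalEnvelopingAlgebra.hom_ext ℂ (LieHom.ext fun x => ?_)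
    show ((UniversalEnvelopingAlgebra.lift ℂ f (UniversalEnvelopingAlgebra.ι ℂ x) : S) : U L) = _
    rw [UniversalEnvelopingAlgebra.lift_ι_apply]
    rfl
  refine eq_top_iff.mpr fun u _ => ?_
  have hu : ((UniversalEnvelopingAlgebra.lift ℂ f u : S) : U L) = u := DFunLike.congr_fun hid u
  exact hu ▸ (UniversalEnvelopingAlgebra.lift ℂ f u).2

/-- The enveloping algebra of an abelian Lie algebra is commutative. -/
instance instCommRingU (Z : Type*) [LieRing Z] [LieAlgebra ℂ Z] [IsLieAbelian Z] :
    CommRing (U Z) :=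
  { (inferInstance : Ring (U Z)) with
    mul_comm := by
      have hι : ∀ x y : Z, Commute (UniversalEnvelopingAlgebra.ι ℂ x : U Z)
          (UniversalEnvelopingAlgebra.ι ℂ y) := fun x y => by
        have h := (UniversalEnvelopingAlgebra.ι ℂ : Z →ₗ⁅ℂ⁆ U Z).map_lie x y
        rw [trivial_lie_zero, _root_.map_zero, LieRing.of_associative_ring_bracket] at h
        exact (sub_eq_zero.mp h.symm)
      have h1 : ∀ x : Z, Subalgebra.centralizer ℂ {(UniversalEnvelopingAlgebra.ι ℂ x : U Z)} = ⊤ :=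
        fun x => subalgebra_eq_top _ fun y => by
          rw [Subalgebra.mem_centralizer_iff]
          rintro _ rfl
          exact hι x y
      have h2 : Subalgebra.center ℂ (U Z) = ⊤ := subalgebra_eq_top _ fun x => by
        rw [Subalgebra.mem_center_iff]
        intro u
        have hu : u ∈ Subalgebra.centralizer ℂ {(UniversalEnvelopingAlgebra.ι ℂ x : U Z)} :=
          h1 x ▸ Algebra.mem_top
        rw [Subalgebra.mem_centralizer_iff] at hu
        exact (hu _ rfl).symm
      intro u v
      have hv : v ∈ Subalgebra.center ℂ (U Z) := h2 ▸ Algebra.mem_top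
      exact Subalgebra.mem_center_iff.mp hv u }

section Action

variable {n : ℕ} {R : Type*} [CommRing R]

/-- The substitution `f(d₁, …, dₙ) ↦ f(d₁ - k₁, …, dₙ - kₙ)`. -/
def shift (k : Fin n → ℤ) : MvPolynomial (Fin n) R →ₐ[R] MvPolynomial (Fin n) R :=
  MvPolynomial.aeval fun j => MvPolynomial.X j - MvPolynomial.C (k j : R)

lemma shift_shift (k l : Fin n → ℤ) (f : MvPolynomial (Fin n) R) :
    shift k (shift l f) = shift (k + l) f := by
  have : (shift k).comp (shift l) = (shift (k + l) : MvPolynomial (Fin n) R →ₐ[R] _) := by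
    refine MvPolynomial.algHom_ext fun j => ?_
    simp [shift, sub_sub]
  exact DFunLike.congr_fun this f

variable [Algebra ℂ R]

/-- The operator `f ↦ Λ^k (dᵢ - kᵢ (a + 1)) f(d₁ - k₁, …, dₙ - kₙ)` on `R[d₁, …, dₙ]`, where
`Λ^k = λ₁^{k₁} ⋯ λₙ^{kₙ}`. -/
def op (Λ : Fin n → ℂˣ) (a : R) (k : Fin n → ℤ) (i : Fin n) :
    Module.End ℂ (MvPolynomial (Fin n) R) where
  toFun f := ((∏ j, Λ j ^ k j : ℂˣ) : ℂ) •
    ((MvPolynomial.X i - MvPolynomial.C ((k i : R) * (a + 1))) * shift k f)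
  map_add' f g := by rw [map_add, mul_add, smul_add]
  map_smul' c f := by
    have : shift k (c • f) = c • shift k f :=
      ((shift k : MvPolynomial (Fin n) R →ₐ[R] _).restrictScalars ℂ).map_smul_of_tower c f
    rw [this, mul_smul_comm, smul_comm, RingHom.id_apply]

lemma op_apply (Λ : Fin n → ℂˣ) (a : R) (k : Fin n → ℤ) (i : Fin n)
    (f : MvPolynomial (Fin n) R) :
    op Λ a k i f = ((∏ j, Λ j ^ k j : ℂˣ) : ℂ) •
      ((MvPolynomial.X i - MvPolynomial.C ((k i : R) * (a + 1))) * shift k f) := rfl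

/-- The linear map `Wₙ → End(R[d₁, …, dₙ])` with `t^k dᵢ ↦ op Λ a k i`. -/
def actLin (Λ : Fin n → ℂˣ) (a : R) : Witt n →ₗ[ℂ] Module.End ℂ (MvPolynomial (Fin n) R) :=
  ∑ i, ofMono (fun k => op Λ a k i) ∘ₗ coef i

lemma actLin_apply (Λ : Fin n → ℂˣ) (a : R) (k : Fin n → ℤ) (i : Fin n) :
    actLin Λ a (mono k • d i) = op Λ a k i := by
  rw [actLin, LinearMap.sum_apply, Finset.sum_eq_single i]
  · simp [coef_smul_d, ofMono_mono]
  · intro j _ hj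
    simp [coef_smul_d, hj]
  · simp

lemma op_lie (Λ : Fin n → ℂˣ) (a : R) (k l : Fin n → ℤ) (i j : Fin n) :
    ⁅op Λ a k i, op Λ a l j⁆ =
      (l i : ℂ) • op Λ a (k + l) j - (k j : ℂ) • op Λ a (k + l) i := by
  refine LinearMap.ext fun f => ?_
  have hΛ : (∏ j, Λ j ^ (k + l) j : ℂˣ) = (∏ j, Λ j ^ k j) * ∏ j, Λ j ^ l j := by
    rw [← Finset.prod_mul_distrib]
    exact Finset.prod_congr rfl fun j _ => zpow_add _ _ _
  have hX : ∀ (m : Fin n → ℤ) (j : Fin n),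
      shift m (MvPolynomial.X j : MvPolynomial (Fin n) R) =
        MvPolynomial.X j - ((m j : ℤ) : MvPolynomial (Fin n) R) := fun m j => by
    simp [shift]
  have hC : ∀ (m : Fin n → ℤ) (r : R), shift m (MvPolynomial.C r) = MvPolynomial.C r :=
    fun m r => MvPolynomial.aeval_C _ _
  have hsm : ∀ (m : Fin n → ℤ) (c : ℂ) (g : MvPolynomial (Fin n) R),
      shift m (c • g) = c • shift m g := fun m c g =>
    ((shift m : MvPolynomial (Fin n) R →ₐ[R] _).restrictScalars ℂ).map_smul_of_tower c g
  rw [LieRing.of_associative_ring_bracket]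
  simp only [LinearMap.sub_apply, LinearMap.smul_apply, Module.End.mul_apply, op_apply, hsm,
    map_mul, map_sub, hX, hC, shift_shift, hΛ, Units.val_mul, add_comm l k]
  simp only [Algebra.smul_def, map_intCast, map_mul, map_add, map_one, Pi.add_apply, Int.cast_add]
  ring

/-- The representation of `Wₙ` on `R[d₁, …, dₙ]`. -/
def act (Λ : Fin n → ℂˣ) (a : R) : Witt n →ₗ⁅ℂ⁆ Module.End ℂ (MvPolynomial (Fin n) R) :=
  { actLin Λ a with
    map_lie' := by
      have h1 : ∀ (k : Fin n → ℤ) (i : Fin n) (ε : Witt n),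
          actLin Λ a ⁅mono k • d i, ε⁆ = ⁅actLin Λ a (mono k • d i), actLin Λ a ε⁆ := by
        intro k i
        have : actLin Λ a ∘ₗ (LieAlgebra.ad ℂ (Witt n) (mono k • d i)) =
            (LieAlgebra.ad ℂ _ (actLin Λ a (mono k • d i))) ∘ₗ actLin Λ a := by
          refine witt_hom_ext fun l j => ?_
          show actLin Λ a ⁅mono k • d i, mono l • d j⁆ =
            ⁅actLin Λ a (mono k • d i), actLin Λ a (mono l • d j)⁆
          rw [bracket_d, map_sub, LinearMap.map_smul, LinearMap.map_smul]
          simp only [actLin_apply, op_lie]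
        exact fun ε => LinearMap.congr_fun this ε
      intro δ ε
      have h2 : actLin Λ a ∘ₗ (LieAlgebra.ad ℂ (Witt n) δ) =
            (LieAlgebra.ad ℂ _ (actLin Λ a δ)) ∘ₗ actLin Λ a := by
        refine witt_hom_ext fun l j => ?_
        show actLin Λ a ⁅δ, mono l • d j⁆ = ⁅actLin Λ a δ, actLin Λ a (mono l • d j)⁆
        rw [← lie_skew, map_neg, h1, lie_skew]
      exact LinearMap.congr_fun h2 ε }

lemma act_apply (Λ : Fin n → ℂˣ) (a : R) (k : Fin n → ℤ) (i : Fin n) :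
    act Λ a (mono k • d i) = op Λ a k i :=
  actLin_apply Λ a k i

lemma act_C_mul (Λ : Fin n → ℂˣ) (a : R) (δ : Witt n) (r : R) (f : MvPolynomial (Fin n) R) :
    act Λ a δ (MvPolynomial.C r * f) = MvPolynomial.C r * act Λ a δ f := by
  have h : (LinearMap.applyₗ (MvPolynomial.C r * f)) ∘ₗ actLin Λ a =
      LinearMap.mulLeft ℂ (MvPolynomial.C r) ∘ₗ (LinearMap.applyₗ f) ∘ₗ actLin Λ a := by
    refine witt_hom_ext fun k i => ?_
    have hC : shift k (MvPolynomial.C r) = MvPolynomial.C r := MvPolynomial.aeval_C _ _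
    simp only [LinearMap.comp_apply, LinearMap.applyₗ_apply_apply, actLin_apply, op_apply,
      LinearMap.mulLeft_apply, map_mul, hC, mul_smul_comm]
    congr 1
    ring
  exact LinearMap.congr_fun h δ

end Action

variable {n : ℕ} {Z : Type*} [LieRing Z] [LieAlgebra ℂ Z] [IsLieAbelian Z]

/-- The space `Ω(Λ, a) = U(Z)[d₁, …, dₙ]`, for `Λ ∈ (ℂ*)ⁿ` and `a ∈ U(Z)`. -/
@[nolint unusedArguments]
def Omega (_Λ : Fin n → ℂˣ) (_a : U Z) : Type _ := MvPolynomial (Fin n) (U Z)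

instance instAddCommGroupOmega (Λ : Fin n → ℂˣ) (a : U Z) : AddCommGroup (Omega Λ a) :=
  inferInstanceAs (AddCommGroup (MvPolynomial (Fin n) (U Z)))

/-- The representation of `Wₙ ⊕ Z` on `U(Z)[d₁, …, dₙ]`: `t^k dᵢ` acts by
`f ↦ Λ^k (dᵢ - kᵢ (a + 1)) f(d₁ - k₁, …, dₙ - kₙ)`, and `z ∈ Z` acts by multiplication. -/
def omegaRep (Λ : Fin n → ℂˣ) (a : U Z) :
    Witt n × Z →ₗ⁅ℂ⁆ Module.End ℂ (MvPolynomial (Fin n) (U Z)) :=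
  { toFun := fun x => act Λ a x.1 +
      LinearMap.mulLeft ℂ (MvPolynomial.C (UniversalEnvelopingAlgebra.ι ℂ x.2))
    map_add' := fun x y => LinearMap.ext fun f => by
      simp only [Prod.fst_add, Prod.snd_add, map_add, LinearMap.add_apply,
        LinearMap.mulLeft_apply, add_mul]
      abel
    map_smul' := fun c x => LinearMap.ext fun f => by
      have hC : ∀ u : U Z, (MvPolynomial.C (c • u) : MvPolynomial (Fin n) (U Z)) =
          c • MvPolynomial.C u := fun u => by
        simp only [Algebra.smul_def, map_mul]
        rfl
      simp only [Prod.smul_fst, Prod.smul_snd, map_smul, hC, LinearMap.add_apply,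
        LinearMap.smul_apply, LinearMap.mulLeft_apply, smul_mul_assoc, smul_add,
        RingHom.id_apply]
    map_lie' := fun {x y} => LinearMap.ext fun f => by
      rw [LieRing.of_associative_ring_bracket]
      simp only [LieAlgebra.Prod.bracket_apply, trivial_lie_zero, LieHom.map_lie, map_zero,
        zero_mul, add_zero, LinearMap.add_apply, LinearMap.sub_apply, Module.End.mul_apply,
        LinearMap.mulLeft_apply, map_add, act_C_mul, LieRing.of_associative_ring_bracket]
      ring }

/-- The `U(Wₙ ⊕ Z)`-module structure of `Ω(Λ, a)`. -/
instance instModuleOmega (Λ : Fin n → ℂˣ) (a : U Z) : Module (U (Witt n × Z)) (Omega Λ a) :=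
  Module.compHom (MvPolynomial (Fin n) (U Z))
    (UniversalEnvelopingAlgebra.lift ℂ (omegaRep Λ a)).toRingHom

lemma omega_smul (Λ : Fin n → ℂˣ) (a : U Z) (k : Fin n → ℤ) (i : Fin n) (z : Z)
    (f : MvPolynomial (Fin n) (U Z)) :
    (UniversalEnvelopingAlgebra.ι ℂ ((mono k • d i, z) : Witt n × Z) : U (Witt n × Z)) •
      (show Omega Λ a from f) = (show Omega Λ a from
        ((∏ j, Λ j ^ k j : ℂˣ) : ℂ) •
          ((MvPolynomial.X i - MvPolynomial.C ((k i : U Z) * (a + 1))) * shift k f) +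
        MvPolynomial.C (UniversalEnvelopingAlgebra.ι ℂ z) * f) := by
  show UniversalEnvelopingAlgebra.lift ℂ (omegaRep Λ a) (UniversalEnvelopingAlgebra.ι ℂ _) f = _
  rw [UniversalEnvelopingAlgebra.lift_ι_apply]
  show act Λ a (mono k • d i) f + _ = _
  rw [act_apply]
  rfl

end Omega

end WittAlgebra

end

/-! `U (DZ n Z)` is the polynomial ring `R[X₁, …, Xₙ]` over `R = U Z`, so `M` may be identified with
this ring, with `dᵢ` acting as `Xᵢ`. Since `[dⱼ, t^k dᵢ] = kⱼ t^k dᵢ` and `U Z` is central, `t^k dᵢ`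
acts by `f ↦ shift k f * g k i`, where `g k i` is the image of `1`. The module is therefore encoded
in the family `g`, subject to the bracket relations (`IsWittCocycle`), and the task is to solve
these relations.

Along a fixed direction `k`, a combination `∂ = ∑ cᵢ dᵢ` with `κ = ∑ cᵢ kᵢ ≠ 0` gives elements
`t^{mk} ∂` that span a copy of `W₁`. Substituting `X - kT` for `X` turns their images of `1` into
polynomials in the single variable `T`, where degrees force linearity (`IsWittSequence.eq`). Varying
`∂` gives `g k i = α_k (Xᵢ - b_{k,i})` with `α_k` a nonzero scalar, because all units of the
coefficient ring are scalars (`IsWittCocycle.exists_eq`, `IsWittCocycle.exists_form`).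

To link different directions, the relation for `mk` and `ml` is read as an identity in `m`. It is an
exponential `(α_k α_l / α_{k+l})^m` times a polynomial, equal to an affine function of `m`. Hence
`α` is multiplicative (`IsWittForm.unit_add`), and comparing coefficients shows that every `b_{k,i}`
is constant (`IsWittForm.natDegree_eq_zero`). The remaining linear relations among these constants
leave one parameter, `b_{k,i} = kᵢ (a + 1)`. -/

noncomputable section

namespace WittAlgebra

/-! ### Rank one: the relations of `W₁` in one-variable polynomials -/

section OneVariable

open Polynomial

lemma degree_taylor_sub_lt {S : Type*} [CommRing S] {p : S[X]} (hp : p ≠ 0) (r : S) :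
    (taylor r p - p).degree < p.degree :=
  degree_sub_lt_right (degree_taylor p r) hp (leadingCoeff_taylor r p)

variable {S : Type*} [CommRing S] [IsDomain S] [CharZero S]

/-- A polynomial with a nonzero period over a domain of characteristic zero is constant. -/
lemma exists_eq_C_of_taylor_eq {p : S[X]} {r : S} (hr : r ≠ 0) (h : taylor r p = p) :
    ∃ c, p = C c := by
  have h1 : ∀ m : ℕ, p.eval ((m : S) * r) = p.eval 0 := by
    intro m
    induction m with
    | zero => simp
    | succ m ih => rw [← ih, Nat.cast_succ, add_mul, one_mul, ← taylor_eval, h]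
  refine ⟨p.eval 0, eq_of_infinite_eval_eq _ _ ?_⟩
  refine Set.Infinite.mono ?_ (Set.infinite_range_of_injective (f := fun m : ℕ => (m : S) * r) ?_)
  · rintro _ ⟨m, rfl⟩
    simp [h1]
  · intro a b hab
    exact_mod_cast mul_right_cancel₀ hr hab

/-- The defining relations of a `W₁`-module structure on `S[X]` extending multiplication by `X`. -/
def IsWittSequence (F : ℤ → S[X]) : Prop :=
  ∀ m l : ℤ, F m * taylor (m : S) (F l) - F l * taylor (l : S) (F m) =
    C ((m - l : ℤ) : S) * F (m + l)

variable {F : ℤ → S[X]}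

/-- The relation for `m` and `-m` says that this product `h` satisfies `h(X + m) - h(X) = 2mX`. The
quadratic `X² - mX` has the same difference, so the two differ by a polynomial of period `m`, which
is constant. -/
lemma IsWittSequence.mul_neg (hF : IsWittSequence F) (hF0 : F 0 = X) {m : ℤ} (hm : m ≠ 0) :
    ∃ c, F (-m) * taylor (-m : S) (F m) = X ^ 2 + C (-m : S) * X + C c := by
  set h := F (-m) * taylor (-m : S) (F m) with hh
  have h1 : taylor (m : S) h = taylor (m : S) (F (-m)) * F m := by
    rw [hh, taylor_mul, taylor_taylor, add_neg_cancel, taylor_zero]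
  have h2 := hF m (-m)
  rw [add_neg_cancel, hF0] at h2
  push_cast at h2
  have hmS : (m : S) ≠ 0 := by exact_mod_cast hm
  obtain ⟨c, hc⟩ := exists_eq_C_of_taylor_eq (p := h - (X ^ 2 + C (-m : S) * X)) hmS (by
    rw [map_sub, h1, map_add, taylor_mul, taylor_X_pow, taylor_C, taylor_X]
    simp only [map_neg, map_sub] at h2 ⊢
    linear_combination h2)
  exact ⟨c, by rw [← hc]; ring⟩

lemma IsWittSequence.natDegree_add (hF : IsWittSequence F) (hF0 : F 0 = X) {m : ℤ}
    (hm : m ≠ 0) : (F (-m)).natDegree + (F m).natDegree = 2 ∧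
      (F (-m)).leadingCoeff * (F m).leadingCoeff = 1 := by
  obtain ⟨c, hc⟩ := hF.mul_neg hF0 hm
  have h1 : (X ^ 2 + C (-m : S) * X + C c) = C 1 * X ^ 2 + C (-m : S) * X + C c := by simp
  have hl := congrArg leadingCoeff hc
  have hd := congrArg natDegree hc
  rw [h1, leadingCoeff_quadratic one_ne_zero, leadingCoeff_mul, leadingCoeff_taylor] at hl
  have h2 : F (-m) ≠ 0 := by rintro h; simp [h] at hl
  have h3 : F m ≠ 0 := by rintro h; simp [h] at hl
  rw [h1, natDegree_quadratic one_ne_zero, natDegree_mul h2 ((taylor_eq_zero _ _).not.2 h3),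
    natDegree_taylor] at hd
  exact ⟨hd, hl⟩

lemma IsWittSequence.ne_zero (hF : IsWittSequence F) (hF0 : F 0 = X) {m : ℤ} (hm : m ≠ 0) :
    F m ≠ 0 := by
  rintro h
  simpa [h] using (hF.natDegree_add hF0 hm).2

/-- If `F m` were a constant `a`, the relation for `m` and `lm` would make `F ((l + 1) * m)`
proportional to a difference of `F (l * m)`, hence of smaller degree. Three successive drops
starting from `F (2 * m)`, whose degree is at most 2, are impossible. -/
lemma IsWittSequence.natDegree_ne_zero (hF : IsWittSequence F) (hF0 : F 0 = X) {m : ℤ}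
    (hm : m ≠ 0) : (F m).natDegree ≠ 0 := by
  intro h0
  obtain ⟨a, ha⟩ := natDegree_eq_zero.1 h0
  have ha0 : a ≠ 0 := by
    rintro rfl
    exact hF.ne_zero hF0 hm (by rw [← ha, C_0])
  have key : ∀ l : ℤ, 2 ≤ l → (F ((l + 1) * m)).natDegree < (F (l * m)).natDegree := by
    intro l hl
    have hne : ∀ j : ℤ, 2 ≤ j → F (j * m) ≠ 0 := fun j hj =>
      hF.ne_zero hF0 (mul_ne_zero (by omega) hm)
    have h1 := hF m (l * m)
    rw [← ha, taylor_C, mul_comm (F (l * m)), ← mul_sub, show m + l * m = (l + 1) * m by ring] at h1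
    have h2 := degree_taylor_sub_lt (hne l hl) (m : S)
    have h3 : ((m - l * m : ℤ) : S) ≠ 0 := by
      rw [Int.cast_ne_zero, show m - l * m = (1 - l) * m by ring]
      exact mul_ne_zero (by omega) hm
    have h4 := congrArg degree h1
    rw [degree_C_mul ha0, degree_C_mul h3] at h4
    rw [h4] at h2
    exact natDegree_lt_natDegree (hne _ (by omega)) h2
  have h2 := (hF.natDegree_add hF0 (mul_ne_zero two_ne_zero hm)).1
  have k2 := key 2 le_rfl
  have k3 := key 3 (by norm_num)
  have k4 := key 4 (by norm_num)
  norm_num at k2 k3 k4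
  omega

/-- A `W₁`-module structure on `S[X]` extending multiplication by `X` is a twist by a unit of one
in which `t^m d` acts on `1` as `X + m b`. -/
theorem IsWittSequence.eq_of_zero (hF : IsWittSequence F) (hF0 : F 0 = X) :
    ∃ (α : Sˣ) (b : S), ∀ m : ℤ, F m = C ((α ^ m : Sˣ) : S) * (X + C ((m : S) * b)) := by
  have hlin : ∀ m : ℤ, ∃ (α : Sˣ) (β : S), F m = C (α : S) * (X + C β) := by
    intro m
    by_cases hm : m = 0
    · exact ⟨1, 0, by simp [hm, hF0]⟩
    · have h1 := hF.natDegree_add hF0 hm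
      have h2 := hF.natDegree_ne_zero hF0 hm
      have h3 := hF.natDegree_ne_zero hF0 (neg_ne_zero.2 hm)
      have h4 : (F m).natDegree = 1 := by omega
      -- The leading coefficients of `F m` and `F (-m)` are mutually inverse, hence units.
      let u : Sˣ := ⟨(F m).leadingCoeff, (F (-m)).leadingCoeff, by rw [mul_comm]; exact h1.2, h1.2⟩
      refine ⟨u, ((u⁻¹ : Sˣ) : S) * (F m).coeff 0, ?_⟩
      rw [mul_add, ← C_mul, Units.mul_inv_cancel_left]
      have h5 : (u : S) = (F m).coeff 1 := by rw [← h4]; rfl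
      rw [h5]
      exact eq_X_add_C_of_natDegree_le_one h4.le
  choose α β hαβ using hlin
  have hrel : ∀ m l : ℤ, m ≠ l → α (m + l) = α m * α l ∧
      ((m - l : ℤ) : S) * β (m + l) = m * β m - l * β l := by
    intro m l hml
    have h := hF m l
    rw [hαβ m, hαβ l, hαβ (m + l)] at h
    simp only [taylor_mul, taylor_C, taylor_X, map_add] at h
    have h1 : C (((α m * α l : Sˣ) : S) * (m - l)) * X +
        C (((α m * α l : Sˣ) : S) * (m * β m - l * β l)) =
        C (((m - l : ℤ) : S) * α (m + l)) * X +
        C (((m - l : ℤ) : S) * α (m + l) * β (m + l)) := by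
      simp only [Units.val_mul, map_mul, map_sub, Int.cast_sub] at h ⊢
      linear_combination h
    have hc1 := congrArg (fun p => coeff p 1) h1
    have hc0 := congrArg (fun p => coeff p 0) h1
    simp only [coeff_add, coeff_C_mul, coeff_X_one, coeff_X_zero, coeff_C_zero,
      coeff_C_succ, mul_zero, mul_one, add_zero, zero_add] at hc1 hc0
    have hmlS : ((m - l : ℤ) : S) ≠ 0 := by rw [Int.cast_ne_zero]; omega
    have hα : α (m + l) = α m * α l := by
      refine Units.ext (mul_left_cancel₀ hmlS ?_)
      rw [← hc1, Int.cast_sub, mul_comm]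
    refine ⟨hα, mul_left_cancel₀ (α m * α l).ne_zero ?_⟩
    rw [hc0, hα]
    ring
  have hα0 : α 0 = 1 := by
    have := (hrel 0 1 (by norm_num)).1
    simpa using this
  have hα : ∀ m l, α (m + l) = α m * α l := by
    intro m l
    by_cases hml : m = l
    · subst hml
      by_cases hm : m = 0
      · simp [hm, hα0]
      · have h1 := (hrel (3 * m) (2 * m) (by omega)).1
        have h2 := (hrel (4 * m) m (by omega)).1
        have h3 := (hrel (3 * m) m (by omega)).1
        rw [show 3 * m + 2 * m = 4 * m + m by ring, h2, show 4 * m = 3 * m + m by ring, h3,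
          mul_assoc] at h1
        rw [← two_mul]
        exact (mul_left_cancel h1).symm
    · exact (hrel m l hml).1
  have hαpow : ∀ m, α m = α 1 ^ m := by
    let φ : Multiplicative ℤ →* Sˣ :=
      { toFun := fun m => α m.toAdd, map_one' := hα0, map_mul' := fun m l => hα _ _ }
    intro m
    have := map_zpow φ (Multiplicative.ofAdd 1) m
    rw [← ofAdd_zsmul, smul_eq_mul, mul_one] at this
    exact this
  have hβ0 : β 0 = 0 := by
    have h := hαβ 0
    rw [hF0, hα0] at h
    simpa using h
  have hβneg : ∀ m, β (-m) = -β m := by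
    intro m
    by_cases hm : m = 0
    · simp [hm, hβ0]
    · have h := (hrel m (-m) (by omega)).2
      rw [add_neg_cancel, hβ0, mul_zero] at h
      have hmS : (m : S) ≠ 0 := by exact_mod_cast hm
      refine mul_left_cancel₀ hmS ?_
      push_cast at h
      linear_combination -h
  have hβ2 : β 2 = 2 * β 1 := by
    have h := (hrel 2 (-1) (by norm_num)).2
    rw [hβneg] at h
    norm_num at h
    refine mul_left_cancel₀ (two_ne_zero (α := S)) ?_
    linear_combination -h
  have hβnat : ∀ m : ℕ, β m = m * β 1 := by
    intro m
    induction m with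
    | zero => simp [hβ0]
    | succ m ih =>
      -- The recursion has the factor `m - 1` in front of `β (m + 1)`, so it says nothing about `β
      -- 2`, which was found from the pair `(2, -1)`.
      by_cases hm : m = 1
      · subst hm; norm_num; exact hβ2
      · have h := (hrel m 1 (by exact_mod_cast hm)).2
        have hmS : ((m : S) - 1) ≠ 0 := by
          rw [sub_ne_zero]; exact_mod_cast hm
        refine mul_left_cancel₀ hmS ?_
        push_cast at h ⊢
        rw [h, ih]
        ring
  refine ⟨α 1, β 1, fun m => ?_⟩
  rw [hαβ m, hαpow m]
  congr 3
  obtain ⟨k, rfl | rfl⟩ := m.eq_nat_or_neg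
  · rw [hβnat]; simp
  · rw [hβneg, hβnat]; simp

theorem IsWittSequence.eq (hF : IsWittSequence F) {y : S} (hF0 : F 0 = X - C y) :
    ∃ (α : Sˣ) (b : S), ∀ m : ℤ, F m = C ((α ^ m : Sˣ) : S) * (X - C y + C ((m : S) * b)) := by
  have hG : IsWittSequence (fun m => taylor y (F m)) := by
    intro m l
    have h := congrArg (taylor y) (hF m l)
    rw [map_sub, taylor_mul, taylor_mul, taylor_mul, taylor_C, taylor_taylor, taylor_taylor,
      add_comm y, add_comm y] at h
    rw [taylor_taylor, taylor_taylor]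
    exact h
  obtain ⟨α, b, h⟩ := hG.eq_of_zero (by simp [hF0])
  refine ⟨α, b, fun m => taylor_injective y ?_⟩
  have h' : taylor y (F m) = _ := h m
  rw [h', taylor_mul, map_add, map_sub, taylor_X, taylor_C, taylor_C, taylor_C,
    add_sub_cancel_right]

end OneVariable

end WittAlgebra

end

noncomputable section

namespace WittAlgebra

/-! ### Solving the relations along one direction `k` -/

section Cocycle

open MvPolynomial

variable {n : ℕ} {R : Type*} [CommRing R]

lemma shift_C (k : Fin n → ℤ) (r : R) : shift k (C r : MvPolynomial (Fin n) R) = C r :=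
  aeval_C _ _

lemma shift_X (k : Fin n → ℤ) (j : Fin n) :
    shift k (X j : MvPolynomial (Fin n) R) = X j - (k j : MvPolynomial (Fin n) R) := by
  simp [shift]

lemma shift_zero (f : MvPolynomial (Fin n) R) : shift 0 f = f := by
  have : shift 0 = AlgHom.id R (MvPolynomial (Fin n) R) := algHom_ext fun j => by simp [shift]
  rw [this, AlgHom.id_apply]

/-- The substitution `f(X) ↦ f(X - kT)`, a generic translation in the direction `k`. -/
def genericShift (k : Fin n → ℤ) :
    MvPolynomial (Fin n) R →ₐ[R] Polynomial (MvPolynomial (Fin n) R) :=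
  aeval fun j => Polynomial.C (X j) - Polynomial.C (k j : MvPolynomial (Fin n) R) * Polynomial.X

lemma genericShift_X (k : Fin n → ℤ) (j : Fin n) :
    genericShift k (X j : MvPolynomial (Fin n) R) = Polynomial.C (X j) -
      Polynomial.C (k j : MvPolynomial (Fin n) R) * Polynomial.X :=
  aeval_X _ _

lemma genericShift_C (k : Fin n → ℤ) (r : R) :
    genericShift k (C r : MvPolynomial (Fin n) R) = Polynomial.C (C r) :=
  aeval_C _ _

lemma eval_genericShift (k : Fin n → ℤ) (m : ℤ) (f : MvPolynomial (Fin n) R) :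
    (genericShift k f).eval (m : MvPolynomial (Fin n) R) = shift (m • k) f := by
  induction f using MvPolynomial.induction_on with
  | C r => simp
  | add p q hp hq => simp only [map_add, Polynomial.eval_add, hp, hq]
  | mul_X p j hp => simp [hp, genericShift_X, shift_X, mul_comm]

lemma eval_zero_genericShift (k : Fin n → ℤ) (f : MvPolynomial (Fin n) R) :
    (genericShift k f).eval 0 = f := by
  simpa [shift_zero] using eval_genericShift k 0 f

lemma coeff_zero_genericShift (k : Fin n → ℤ) (f : MvPolynomial (Fin n) R) :
    (genericShift k f).coeff 0 = f := by
  rw [Polynomial.coeff_zero_eq_eval_zero, eval_zero_genericShift]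

/-- The reason for introducing `T`: the shift by `mk` becomes the translation `T ↦ T + m`, so
relations along `k` turn into those of `IsWittSequence`. -/
lemma genericShift_shift (k : Fin n → ℤ) (m : ℤ) (f : MvPolynomial (Fin n) R) :
    genericShift k (shift (m • k) f) =
      Polynomial.taylor (m : MvPolynomial (Fin n) R) (genericShift k f) := by
  induction f using MvPolynomial.induction_on with
  | C r => rw [shift_C, genericShift_C, Polynomial.taylor_C]
  | add p q hp hq => simp only [map_add, hp, hq]
  | mul_X p j hp =>
    simp only [map_mul, hp, genericShift_X, shift_X, map_sub, map_intCast, Pi.smul_apply,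
      smul_eq_mul, Int.cast_mul, Polynomial.taylor_mul, Polynomial.taylor_X, Polynomial.taylor_C]
    have h (a : ℤ) : Polynomial.taylor (m : MvPolynomial (Fin n) R)
        (a : Polynomial (MvPolynomial (Fin n) R)) = a := by
      rw [← map_intCast (Polynomial.C (R := MvPolynomial (Fin n) R)) a, Polynomial.taylor_C]
    rw [h]
    ring

lemma genericShift_nsmul (m : ℕ) (k : Fin n → ℤ) (f : MvPolynomial (Fin n) R) :
    genericShift (m • k) f =
      (genericShift k f).comp (Polynomial.C (m : MvPolynomial (Fin n) R) * Polynomial.X) := by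
  induction f using MvPolynomial.induction_on with
  | C r => rw [genericShift_C, genericShift_C, Polynomial.C_comp]
  | add p q hp hq => simp only [map_add, Polynomial.add_comp, hp, hq]
  | mul_X p j hp =>
    simp only [map_mul, hp, genericShift_X, Polynomial.mul_comp, Polynomial.sub_comp,
      Polynomial.C_comp, Polynomial.X_comp]
    simp
    ring

lemma shift_comm (k l : Fin n → ℤ) (f : MvPolynomial (Fin n) R) :
    shift k (shift l f) = shift l (shift k f) := by
  rw [shift_shift, shift_shift, add_comm]

/-- Every point with coordinates in `-ℕ` is reached from the origin by a shift, and a polynomial is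
determined by its values on these points. -/
lemma exists_eq_C_of_shift_eq [IsDomain R] [CharZero R] {f : MvPolynomial (Fin n) R}
    (hf : ∀ k, shift k f = f) : ∃ r, f = C r := by
  refine ⟨eval 0 f, funext_set (fun _ => Set.range fun m : ℕ => -(m : R)) (fun _ =>
    Set.infinite_range_of_injective fun a c hac => by simpa using hac) fun x hx => ?_⟩
  have hx' : ∀ i, ∃ m : ℕ, -(m : R) = x i := fun i => hx i (Set.mem_univ i)
  choose m hm using hx'
  have h1 : ∀ p : MvPolynomial (Fin n) R, eval x p = eval 0 (shift (fun i => (m i : ℤ)) p) := by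
    intro p
    induction p using MvPolynomial.induction_on with
    | C r => rw [shift_C, eval_C, eval_C]
    | add p q hp hq => rw [map_add, map_add, map_add, hp, hq]
    | mul_X p j hp =>
      rw [map_mul, map_mul, map_mul, hp, shift_X, eval_X, ← hm j]
      simp
  rw [h1, hf, eval_C]

variable [Algebra ℂ R]

lemma shift_algebraMap (k : Fin n → ℤ) (c : ℂ) :
    shift k (algebraMap ℂ (MvPolynomial (Fin n) R) c) = algebraMap ℂ _ c :=
  shift_C _ _

lemma genericShift_algebraMap (k : Fin n → ℤ) (c : ℂ) :
    genericShift k (algebraMap ℂ (MvPolynomial (Fin n) R) c) = Polynomial.C (algebraMap ℂ _ c) :=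
  genericShift_C _ _

/-- The polynomials `g k i` are the images of `1` under the operators `t^k dᵢ` of a
`Wₙ`-module structure on `R[X₁, …, Xₙ]` in which `dᵢ` acts as multiplication by `Xᵢ`. -/
structure IsWittCocycle (g : (Fin n → ℤ) → Fin n → MvPolynomial (Fin n) R) : Prop where
  zero : ∀ i, g 0 i = X i
  rel : ∀ k l i j, g k i * shift k (g l j) - g l j * shift l (g k i) =
    (l i : MvPolynomial (Fin n) R) * g (k + l) j - (k j : MvPolynomial (Fin n) R) * g (k + l) i

variable {g : (Fin n → ℤ) → Fin n → MvPolynomial (Fin n) R}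

/-- The image of `1` under `t^{mk} ∑ᵢ cᵢ dᵢ`. -/
def combination (g : (Fin n → ℤ) → Fin n → MvPolynomial (Fin n) R) (c : Fin n → ℂ)
    (k : Fin n → ℤ) (m : ℤ) : MvPolynomial (Fin n) R :=
  ∑ i, algebraMap ℂ _ (c i) * g (m • k) i

/-- These are the `W₁` relations for `t^{mk} ∂`, up to the scalar `∑ i, c i * k i`; dividing by it
is possible exactly when it is nonzero. -/
lemma IsWittCocycle.combination_rel (hg : IsWittCocycle g) (c : Fin n → ℂ) (k : Fin n → ℤ)
    (m l : ℤ) : combination g c k m * shift (m • k) (combination g c k l) -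
      combination g c k l * shift (l • k) (combination g c k m) =
      algebraMap ℂ _ (∑ i, c i * k i) * (((l - m : ℤ) : MvPolynomial (Fin n) R) *
        combination g c k (m + l)) := by
  have h1 : ∀ (i j : Fin n), algebraMap ℂ (MvPolynomial (Fin n) R) (c i) * algebraMap ℂ _ (c j) *
      (g (m • k) i * shift (m • k) (g (l • k) j) - g (l • k) j * shift (l • k) (g (m • k) i)) =
      l * ((algebraMap ℂ _ (c i) * k i) * (algebraMap ℂ _ (c j) * g ((m + l) • k) j)) -
      m * ((algebraMap ℂ _ (c i) * g ((m + l) • k) i) * (algebraMap ℂ _ (c j) * k j)) := by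
    intro i j
    rw [hg.rel, ← add_smul]
    simp only [Pi.smul_apply, smul_eq_mul, Int.cast_mul]
    ring
  have h2 := Finset.sum_congr rfl fun i (_ : i ∈ Finset.univ) =>
    Finset.sum_congr rfl fun j (_ : j ∈ Finset.univ) => h1 i j
  simp only [Finset.sum_sub_distrib, ← Finset.mul_sum, ← Finset.sum_mul] at h2
  simp only [combination, map_sum, map_mul, shift_algebraMap, map_intCast, Int.cast_sub]
  rw [Finset.sum_mul_sum, Finset.sum_mul_sum, Finset.sum_comm (f := fun i j =>
    algebraMap ℂ _ (c i) * g (l • k) i * _), ← Finset.sum_sub_distrib]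
  simp only [← Finset.sum_sub_distrib]
  refine Eq.trans ?_ (h2.trans (by ring))
  refine Finset.sum_congr rfl fun i _ => ?_
  refine Finset.sum_congr rfl fun j _ => ?_
  ring

lemma exists_algebraMap_eq_unit [IsDomain R] (hR : ∀ u : Rˣ, ∃ c : ℂ, algebraMap ℂ R c = u)
    (u : (MvPolynomial (Fin n) R)ˣ) :
    ∃ c : ℂˣ, algebraMap ℂ (MvPolynomial (Fin n) R) c = u := by
  obtain ⟨r, hr, hu⟩ := isUnit_iff_eq_C_of_isReduced.1 u.isUnit
  obtain ⟨v, rfl⟩ := hr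
  obtain ⟨c, hc⟩ := hR v
  have hc0 : c ≠ 0 := by
    rintro rfl
    rw [map_zero] at hc
    exact v.ne_zero hc.symm
  exact ⟨Units.mk0 c hc0, by rw [hu, ← hc]; rfl⟩

lemma IsWittCocycle.combination_eq [IsDomain R]
    (hR : ∀ u : Rˣ, ∃ c : ℂ, algebraMap ℂ R c = u) (hg : IsWittCocycle g)
    (c : Fin n → ℂ) (k : Fin n → ℤ) (hck : ∑ i, c i * k i ≠ 0) :
    ∃ (α : ℂˣ) (β : MvPolynomial (Fin n) R), genericShift k β = Polynomial.C β ∧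
      ∀ m : ℤ, combination g c k m = algebraMap ℂ _ ((α ^ m : ℂˣ) : ℂ) *
        (∑ i, algebraMap ℂ _ (c i) * X i - (m : MvPolynomial (Fin n) R) * β) := by
  have : CharZero R := charZero_of_injective_algebraMap (algebraMap ℂ R).injective
  set κ : ℂ := ∑ i, c i * k i with hκ
  set w : MvPolynomial (Fin n) R := ∑ i, algebraMap ℂ _ (c i) * X i with hw
  have hκw : genericShift k w = Polynomial.C w -
      Polynomial.C (algebraMap ℂ _ κ) * Polynomial.X := by
    simp only [hw, hκ, map_sum, map_mul, genericShift_algebraMap, genericShift_X, mul_sub,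
      Finset.sum_sub_distrib, Finset.sum_mul, map_intCast, mul_assoc]
  set a : MvPolynomial (Fin n) R := algebraMap ℂ _ κ⁻¹ with ha
  have haκ : a * algebraMap ℂ _ κ = 1 := by
    rw [ha, ← map_mul, inv_mul_cancel₀ hck, map_one]
  have haκ' : Polynomial.C a * Polynomial.C (algebraMap ℂ _ κ) = 1 := by
    rw [← Polynomial.C_mul, haκ, Polynomial.C_1]
  -- The factor `-κ⁻¹` normalises the leading coefficient of `F 0` to 1 and turns `κ (l - m)` into
  -- `m - l`.
  set F : ℤ → Polynomial (MvPolynomial (Fin n) R) :=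
    fun m => -(Polynomial.C a * genericShift k (combination g c k m)) with hF
  have hF0 : F 0 = Polynomial.X - Polynomial.C (a * w) := by
    have : combination g c k 0 = w := by simp [combination, hw, hg.zero]
    simp only [hF, this, hκw, Polynomial.C_mul]
    linear_combination Polynomial.X * haκ'
  have hFW : IsWittSequence F := by
    intro m l
    have h := congrArg (genericShift k) (hg.combination_rel c k m l)
    simp only [map_sub, map_mul, genericShift_shift, genericShift_algebraMap, map_intCast,
      Int.cast_sub] at h
    simp only [hF, map_neg, Polynomial.taylor_mul, Polynomial.taylor_C, map_sub, map_intCast,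
      Int.cast_sub]
    linear_combination Polynomial.C a ^ 2 * h + Polynomial.C a * (l - m) *
      genericShift k (combination g c k (m + l)) * haκ'
  obtain ⟨α, b, hαb⟩ := hFW.eq hF0
  obtain ⟨α', hα'⟩ := exists_algebraMap_eq_unit hR α
  have hpow : ∀ m : ℤ, algebraMap ℂ (MvPolynomial (Fin n) R) ((α' ^ m : ℂˣ) : ℂ) =
      ((α ^ m : (MvPolynomial (Fin n) R)ˣ) : MvPolynomial (Fin n) R) := by
    intro m
    have h : Units.map (algebraMap ℂ (MvPolynomial (Fin n) R)).toMonoidHom α' = α :=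
      Units.ext hα'
    rw [← h, ← map_zpow]
    rfl
  have hG : ∀ m : ℤ, combination g c k m = algebraMap ℂ _ ((α' ^ m : ℂˣ) : ℂ) *
      (w - (m : MvPolynomial (Fin n) R) * (algebraMap ℂ _ κ * b)) := by
    intro m
    have h := congrArg (Polynomial.eval 0) (hαb m)
    simp only [hF, Polynomial.eval_neg, Polynomial.eval_mul, Polynomial.eval_C,
      eval_zero_genericShift, Polynomial.eval_add, Polynomial.eval_sub, Polynomial.eval_X] at h
    rw [hpow]
    linear_combination -algebraMap ℂ _ κ * h - (combination g c k m -
      ((α ^ m : (MvPolynomial (Fin n) R)ˣ) : MvPolynomial (Fin n) R) * w) * haκ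
  refine ⟨α', algebraMap ℂ _ κ * b, ?_, hG⟩
  -- Invariance of `β` along `k`: the case `m = 1` is compared with `genericShift k` applied to its
  -- own specialisation at `T = 0`.
  have h1 := hαb 1
  have h2 := congrArg (genericShift k) (hG 1)
  simp only [zpow_one, Int.cast_one, one_mul] at h1 h2
  rw [hα'] at h2
  rw [map_mul, ← hα', genericShift_algebraMap, map_sub, hκw, hα'] at h2
  have hα0 : Polynomial.C (α : MvPolynomial (Fin n) R) ≠ 0 :=
    Polynomial.C_ne_zero.2 α.ne_zero
  refine mul_left_cancel₀ hα0 ?_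
  simp only [hF, Polynomial.C_mul] at h1
  rw [Polynomial.C_mul]
  linear_combination h2 + Polynomial.C (algebraMap ℂ _ κ) * h1 +
    (genericShift k (combination g c k 1) - Polynomial.C (α : MvPolynomial (Fin n) R) *
      Polynomial.C w) * haκ'

/-- The case `∂ = dᵢ + s dⱼ`. The last conclusion reads `α` off the coefficient of `T`, which allows
the scalars for different `s` to be compared. -/
lemma IsWittCocycle.add_smul_eq [IsDomain R]
    (hR : ∀ u : Rˣ, ∃ c : ℂ, algebraMap ℂ R c = u) (hg : IsWittCocycle g)
    (k : Fin n → ℤ) (i j : Fin n) (s : ℂ) (hs : (k i : ℂ) + s * k j ≠ 0) :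
    ∃ (α : ℂˣ) (β : MvPolynomial (Fin n) R), genericShift k β = Polynomial.C β ∧
      (∀ m : ℤ, g (m • k) i + algebraMap ℂ _ s * g (m • k) j =
        algebraMap ℂ _ ((α ^ m : ℂˣ) : ℂ) *
          (X i + algebraMap ℂ _ s * X j - (m : MvPolynomial (Fin n) R) * β)) ∧
      (genericShift k (g k i)).coeff 1 + algebraMap ℂ _ s * (genericShift k (g k j)).coeff 1 =
        -algebraMap ℂ _ (α * (k i + s * k j)) := by
  let c : Fin n → ℂ := fun x => (if x = i then 1 else 0) + (if x = j then s else 0)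
  have hc : ∀ f : Fin n → MvPolynomial (Fin n) R,
      ∑ x, algebraMap ℂ _ (c x) * f x = f i + algebraMap ℂ _ s * f j := by
    intro f
    simp only [c, map_add, add_mul, Finset.sum_add_distrib, apply_ite (algebraMap ℂ _), map_one,
      map_zero, ite_mul, one_mul, zero_mul, Finset.sum_ite_eq', Finset.mem_univ, if_true]
  have hck : ∑ x, c x * k x = k i + s * k j := by
    simp only [c, add_mul, Finset.sum_add_distrib, ite_mul, one_mul, zero_mul,
      Finset.sum_ite_eq', Finset.mem_univ, if_true]
  obtain ⟨α, β, hβ, h⟩ := hg.combination_eq hR c k (by rwa [hck])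
  simp only [combination, hc] at h
  refine ⟨α, β, hβ, h, ?_⟩
  have h1 := congrArg (fun f => (genericShift k f).coeff 1) (h 1)
  simp only [one_smul, zpow_one, Int.cast_one, one_mul, map_add, map_mul, map_sub,
    genericShift_algebraMap, genericShift_X, hβ, Polynomial.coeff_add, Polynomial.coeff_sub,
    Polynomial.coeff_C_mul, Polynomial.coeff_X_one, Polynomial.coeff_C_succ] at h1
  rw [h1]
  simp only [map_mul, map_add, map_intCast]
  ring

/-- The point is that a single `α` serves all `i`, including those with `k i = 0`, for which `dᵢ`
alone gives no copy of `W₁`. Such `i` are reached by adding a multiple of some `dⱼ` with `k j ≠ 0`.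
For `k = 0` the data are not determined by `g`, so they are fixed by convention. -/
theorem IsWittCocycle.exists_eq [IsDomain R]
    (hR : ∀ u : Rˣ, ∃ c : ℂ, algebraMap ℂ R c = u) (hg : IsWittCocycle g) (k : Fin n → ℤ) :
    ∃ (α : ℂˣ) (b : Fin n → MvPolynomial (Fin n) R),
      (k = 0 → α = 1 ∧ b = 0) ∧ (∀ i, genericShift k (b i) = Polynomial.C (b i)) ∧
      ∀ (m : ℤ) (i : Fin n), g (m • k) i = algebraMap ℂ _ ((α ^ m : ℂˣ) : ℂ) *
        (X i - (m : MvPolynomial (Fin n) R) * b i) := by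
  by_cases hk : k = 0
  · subst hk
    exact ⟨1, 0, by simp, by simp, fun m i => by simp [hg.zero]⟩
  obtain ⟨j, hj⟩ : ∃ j, k j ≠ 0 := Function.ne_iff.1 hk
  have hjC : (k j : ℂ) ≠ 0 := by exact_mod_cast hj
  obtain ⟨α, β, hβ, hα, hφ⟩ := hg.add_smul_eq hR k j j 0 (by simpa using hjC)
  simp only [map_zero, zero_mul, add_zero] at hα hφ
  have hι : Function.Injective (algebraMap ℂ (MvPolynomial (Fin n) R)) :=
    (algebraMap ℂ _).injective
  have key : ∀ i, ∃ b : MvPolynomial (Fin n) R, genericShift k b = Polynomial.C b ∧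
      ∀ m : ℤ, g (m • k) i = algebraMap ℂ _ ((α ^ m : ℂˣ) : ℂ) *
        (X i - (m : MvPolynomial (Fin n) R) * b) := by
    intro i
    have hs : (k i : ℂ) + (1 - k i) / k j * k j = 1 := by field_simp; ring
    obtain ⟨α₁, β₁, hβ₁, hα₁, hφ₁⟩ :=
      hg.add_smul_eq hR k i j ((1 - k i) / k j) (by rw [hs]; exact one_ne_zero)
    set s : ℂ := (1 - k i) / k j with hsdef
    obtain ⟨ν, hν⟩ : ∃ ν : ℂ, (genericShift k (g k i)).coeff 1 = algebraMap ℂ _ ν := by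
      refine ⟨-α₁ + s * (α * k j), ?_⟩
      rw [hs, hφ] at hφ₁
      simp only [mul_one, map_add, map_mul, map_neg] at hφ₁ ⊢
      linear_combination hφ₁
    rw [hν, hφ, hs, mul_one] at hφ₁
    -- Otherwise `s = ν / (α kⱼ)` is an admissible parameter for which the coefficient of `T` in the
    -- combination cancels, although it must be a nonzero multiple of a unit.
    have hν' : ν = -(α * k i) := by
      by_contra hne
      have hα0 : (α : ℂ) ≠ 0 := α.ne_zero
      have hne' : (k i : ℂ) + ν / (α * k j) * k j ≠ 0 := by
        intro h0
        apply hne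
        field_simp at h0
        linear_combination h0
      obtain ⟨α₂, -, -, -, hφ₂⟩ := hg.add_smul_eq hR k i j (ν / (α * k j)) hne'
      rw [hν, hφ, ← map_neg, ← map_neg, ← map_mul, ← map_add] at hφ₂
      have h2 := hι hφ₂
      refine mul_ne_zero α₂.ne_zero hne' ?_
      have : ν + ν / (α * k j) * -(α * k j) = 0 := by field_simp; ring
      linear_combination h2 - this
    have hα' : α₁ = α := by
      rw [← map_neg, ← map_neg, ← map_mul, ← map_add] at hφ₁
      have := hι hφ₁
      refine Units.ext ?_
      linear_combination this - hν' + (α : ℂ) * hs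
    refine ⟨β₁ - algebraMap ℂ _ s * β, ?_, fun m => ?_⟩
    · rw [map_sub, map_mul, genericShift_algebraMap, hβ, hβ₁, map_sub, map_mul]
    · have h1 := hα₁ m
      rw [hα'] at h1
      linear_combination h1 - algebraMap ℂ _ s * hα m
  choose b hb using key
  exact ⟨α, b, fun h => (hk h).elim, fun i => (hb i).1, fun m i => (hb i).2 m⟩

end Cocycle

end WittAlgebra

end

noncomputable section

namespace WittAlgebra

/-! ### Exponential polynomials in an integer parameter -/

section Exponential

open Polynomial

variable {S : Type*} [CommRing S] [IsDomain S] [CharZero S]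

lemma eq_of_eval_natCast_eq {p q : S[X]} (h : ∀ m : ℕ, m ≠ 0 → p.eval (m : S) = q.eval (m : S)) :
    p = q := by
  refine eq_of_infinite_eval_eq _ _ (Set.Infinite.mono ?_
    (Set.infinite_range_of_injective (f := fun m : ℕ => ((m + 1 : ℕ) : S)) ?_))
  · rintro _ ⟨m, rfl⟩
    exact h _ m.succ_ne_zero
  · intro a b hab
    simpa using hab

/-- A nonzero exponential polynomial `ρ^m P(m)` can only be affine in `m` if `ρ = 1`. -/
lemma eq_one_of_pow_mul_eval_eq {P : S[X]} (hP : P ≠ 0) {ρ u v : S} (hρ : ρ ≠ 0)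
    (h : ∀ m : ℕ, m ≠ 0 → ρ ^ m * P.eval (m : S) = u + m * v) : ρ = 1 := by
  -- The second difference of an affine function vanishes; the top coefficient of the resulting
  -- identity is `(ρ - 1) ^ 2` times that of `P`.
  have h1 : C (ρ ^ 2) * taylor 2 P - C (2 * ρ) * taylor 1 P + P = 0 := by
    refine eq_of_eval_natCast_eq fun m hm => ?_
    have h0 := h m hm
    have h1 := h (m + 1) (by omega)
    have h2 := h (m + 2) (by omega)
    push_cast at h1 h2
    simp only [eval_add, eval_sub, eval_mul, eval_C, taylor_eval, eval_zero]
    refine mul_left_cancel₀ (pow_ne_zero m hρ) ?_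
    linear_combination h2 - 2 * h1 + h0
  have h2 := congrArg (fun p => coeff p P.natDegree) h1
  simp only [coeff_add, coeff_sub, coeff_C_mul, coeff_taylor_natDegree, coeff_zero,
    coeff_natDegree] at h2
  have h3 : (ρ - 1) ^ 2 * P.leadingCoeff = 0 := by linear_combination h2
  rcases mul_eq_zero.1 h3 with h4 | h4
  · exact sub_eq_zero.1 (pow_eq_zero_iff two_ne_zero |>.1 h4)
  · exact absurd (leadingCoeff_eq_zero.1 h4) hP

end Exponential

/-! ### Comparing different directions, and the classification of cocycles -/

section Form

open MvPolynomial

variable {n : ℕ} {R : Type*} [CommRing R] [Algebra ℂ R]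
  {g : (Fin n → ℤ) → Fin n → MvPolynomial (Fin n) R}

/-- The normal form `g k i = α_k (Xᵢ - b_{k,i})` of a cocycle, with `b_{k,i}` invariant under
translation by `k` and `α`, `b` compatible with multiples. -/
structure IsWittForm (g : (Fin n → ℤ) → Fin n → MvPolynomial (Fin n) R)
    (α : (Fin n → ℤ) → ℂˣ) (b : (Fin n → ℤ) → Fin n → MvPolynomial (Fin n) R) : Prop where
  eq : ∀ k i, g k i = algebraMap ℂ _ (α k : ℂ) * (X i - b k i)
  inv : ∀ k i, genericShift k (b k i) = Polynomial.C (b k i)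
  unit_zsmul : ∀ (m : ℤ) k, α (m • k) = α k ^ m
  zsmul : ∀ (m : ℤ) k i, b (m • k) i = (m : MvPolynomial (Fin n) R) * b k i

theorem IsWittCocycle.exists_form [IsDomain R]
    (hR : ∀ u : Rˣ, ∃ c : ℂ, algebraMap ℂ R c = u) (hg : IsWittCocycle g) :
    ∃ α b, IsWittForm g α b := by
  have : CharZero R := charZero_of_injective_algebraMap (algebraMap ℂ R).injective
  choose α b h0 hinv heq using hg.exists_eq hR
  have heq1 : ∀ k i, g k i = algebraMap ℂ _ (α k : ℂ) * (X i - b k i) := fun k i => by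
    simpa using heq k 1 i
  have hι : Function.Injective (algebraMap ℂ (MvPolynomial (Fin n) R)) :=
    (algebraMap ℂ _).injective
  have hshift : ∀ k i, ∀ m : ℤ, shift (m • k) (b k i) = b k i := fun k i m => by
    rw [← eval_genericShift, hinv, Polynomial.eval_C]
  have hα : ∀ (m : ℤ) k, α (m • k) = α k ^ m := by
    intro m k
    by_cases hk : m • k = 0
    · rcases smul_eq_zero.1 hk with h | h
      · rw [(h0 _ hk).1, h, zpow_zero]
      · rw [(h0 _ hk).1, (h0 _ h).1, one_zpow]
    · obtain ⟨j, hj⟩ : ∃ j, (m • k) j ≠ 0 := Function.ne_iff.1 hk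
      have h1 : algebraMap ℂ _ (α (m • k) : ℂ) * (X j - b (m • k) j) =
          algebraMap ℂ _ ((α k ^ m : ℂˣ) : ℂ) * (X j - (m : MvPolynomial (Fin n) R) * b k j) := by rw [← heq1, heq]
      -- Both `b` terms are invariant under this shift, so subtracting the shifted identity leaves
      -- only the two scalars times `(m • k) j`.
      have h2 := congrArg (shift (m • k)) h1
      have h3 : shift (m • k) (b (m • k) j) = b (m • k) j := by
        simpa using hshift (m • k) j 1
      simp only [map_mul, map_sub, shift_algebraMap, shift_X, map_intCast, hshift, h3] at h2
      have hj' : ((m • k) j : MvPolynomial (Fin n) R) ≠ 0 := by exact_mod_cast hj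
      refine Units.ext (hι (mul_right_cancel₀ hj' ?_))
      linear_combination h1 - h2
  refine ⟨α, b, heq1, hinv, hα, fun m k i => ?_⟩
  have h1 : algebraMap ℂ _ (α (m • k) : ℂ) * (X i - b (m • k) i) =
      algebraMap ℂ _ ((α k ^ m : ℂˣ) : ℂ) * (X i - (m : MvPolynomial (Fin n) R) * b k i) := by rw [← heq1, heq]
  rw [hα] at h1
  have h2 := mul_left_cancel₀ ((map_ne_zero_iff _ hι).2 (α k ^ m).ne_zero) h1
  linear_combination -h2

/-- Up to an exponential factor, the left side of the cocycle relation for `mk, ml`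
as a polynomial in `m`. -/
def relPoly (b : (Fin n → ℤ) → Fin n → MvPolynomial (Fin n) R) (k l : Fin n → ℤ) (i j : Fin n) :
    Polynomial (MvPolynomial (Fin n) R) :=
  Polynomial.C ((l i : MvPolynomial (Fin n) R) * X j - (k j : MvPolynomial (Fin n) R) * X i) -
    Polynomial.C (X i) * (genericShift k (b l j) - Polynomial.C (b l j)) +
    Polynomial.C (X j) * (genericShift l (b k i) - Polynomial.C (b k i)) +
    (Polynomial.C ((k j : MvPolynomial (Fin n) R) * b k i - (l i : MvPolynomial (Fin n) R) * b l j) +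
      Polynomial.C (b k i) * genericShift k (b l j) -
      Polynomial.C (b l j) * genericShift l (b k i)) * Polynomial.X

variable {α : (Fin n → ℤ) → ℂˣ} {b : (Fin n → ℤ) → Fin n → MvPolynomial (Fin n) R}

lemma IsWittForm.eval_relPoly [IsDomain R] (hg : IsWittCocycle g) (h : IsWittForm g α b)
    (k l : Fin n → ℤ) (i j : Fin n) (m : ℕ) (hm : m ≠ 0) :
    algebraMap ℂ (MvPolynomial (Fin n) R) ((α k * α l : ℂˣ) : ℂ) ^ m *
      (relPoly b k l i j).eval (m : MvPolynomial (Fin n) R) =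
    algebraMap ℂ (MvPolynomial (Fin n) R) (α (k + l) : ℂ) ^ m *
      (((l i : MvPolynomial (Fin n) R) * X j - (k j : MvPolynomial (Fin n) R) * X i) + (m : MvPolynomial (Fin n) R) *
        ((k j : MvPolynomial (Fin n) R) * b (k + l) i -
          (l i : MvPolynomial (Fin n) R) * b (k + l) j)) := by
  have : CharZero R := charZero_of_injective_algebraMap (algebraMap ℂ R).injective
  have hrel := hg.rel ((m : ℤ) • k) ((m : ℤ) • l) i j
  rw [← smul_add] at hrel
  simp only [h.eq, h.unit_zsmul, h.zsmul, map_mul, map_sub, shift_algebraMap, shift_X,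
    map_natCast, zpow_natCast, Units.val_pow_eq_pow_val, map_pow, Pi.smul_apply, smul_eq_mul,
    Int.cast_mul, Int.cast_natCast] at hrel
  have he : ∀ k l j, (genericShift k (b l j)).eval (m : MvPolynomial (Fin n) R) =
      shift ((m : ℤ) • k) (b l j) := fun k l j => by
    rw [← eval_genericShift, Int.cast_natCast]
  have hm' : (m : MvPolynomial (Fin n) R) ≠ 0 := by exact_mod_cast hm
  refine mul_left_cancel₀ hm' ?_
  simp only [relPoly, Polynomial.eval_add, Polynomial.eval_sub, Polynomial.eval_mul,
    Polynomial.eval_C, Polynomial.eval_X, he, Units.val_mul, map_mul, mul_pow]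
  linear_combination hrel

/-- At `T = 0` the polynomial takes the value `(lᵢ - kᵢ) Xᵢ`. -/
lemma relPoly_ne_zero [IsDomain R] {k l : Fin n → ℤ} {i : Fin n} (hkl : k i ≠ l i) :
    relPoly b k l i i ≠ 0 := by
  have : CharZero R := charZero_of_injective_algebraMap (algebraMap ℂ R).injective
  intro h
  have h1 := congrArg (Polynomial.eval 0) h
  simp only [relPoly, Polynomial.eval_add, Polynomial.eval_sub, Polynomial.eval_mul,
    Polynomial.eval_C, Polynomial.eval_X, eval_zero_genericShift, Polynomial.eval_zero] at h1
  have h2 : ((l i - k i : ℤ) : MvPolynomial (Fin n) R) * X i = 0 := by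
    push_cast
    linear_combination h1
  rcases mul_eq_zero.1 h2 with h3 | h3
  · rw [Int.cast_eq_zero] at h3
    omega
  · exact X_ne_zero i h3

/-- Apply `eq_one_of_pow_mul_eval_eq` with `ρ = α_k α_l / α_{k+l}`. This needs a nonzero `relPoly`,
hence a coordinate where `k` and `l` differ; equal indices are covered by `unit_zsmul`. -/
lemma IsWittForm.unit_add [IsDomain R] (hg : IsWittCocycle g) (h : IsWittForm g α b)
    (k l : Fin n → ℤ) : α (k + l) = α k * α l := by
  have : CharZero R := charZero_of_injective_algebraMap (algebraMap ℂ R).injective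
  by_cases hkl : k = l
  · subst hkl
    have := h.unit_zsmul 2 k
    rwa [two_smul, zpow_ofNat, sq] at this
  · obtain ⟨i, hi⟩ := Function.ne_iff.1 hkl
    have hι : Function.Injective (algebraMap ℂ (MvPolynomial (Fin n) R)) :=
      (algebraMap ℂ _).injective
    have h1 := eq_one_of_pow_mul_eval_eq (relPoly_ne_zero (R := R) (b := b) hi)
      (ρ := algebraMap ℂ _ (((α (k + l))⁻¹ * (α k * α l) : ℂˣ) : ℂ))
      ((map_ne_zero_iff _ hι).2 (Units.ne_zero _)) (fun m hm => by
        refine mul_left_cancel₀ (pow_ne_zero m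
          ((map_ne_zero_iff _ hι).2 (α (k + l)).ne_zero)) ?_
        rw [← h.eval_relPoly hg k l i i m hm, ← mul_assoc, ← mul_pow, ← map_mul,
          ← Units.val_mul, mul_inv_cancel_left])
    rw [← map_one (algebraMap ℂ (MvPolynomial (Fin n) R))] at h1
    exact (inv_mul_eq_one.1 (Units.ext (hι h1)))

/-- Once the exponential factors cancel, both sides are polynomials agreeing at all positive
integers. Thus `relPoly` is affine in `T`; the next two lemmas extract its linear and its higher
coefficients. -/
lemma IsWittForm.relPoly_eq [IsDomain R] (hg : IsWittCocycle g) (h : IsWittForm g α b)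
    (k l : Fin n → ℤ) (i j : Fin n) :
    relPoly b k l i j =
      Polynomial.C ((l i : MvPolynomial (Fin n) R) * X j - (k j : MvPolynomial (Fin n) R) * X i) +
      Polynomial.C ((k j : MvPolynomial (Fin n) R) * b (k + l) i -
          (l i : MvPolynomial (Fin n) R) * b (k + l) j) * Polynomial.X := by
  have : CharZero R := charZero_of_injective_algebraMap (algebraMap ℂ R).injective
  refine eq_of_eval_natCast_eq fun m hm => ?_
  have h1 := h.eval_relPoly hg k l i j m hm
  rw [h.unit_add hg] at h1
  rw [mul_left_cancel₀ (pow_ne_zero m ((map_ne_zero_iff _ (algebraMap ℂ _).injective).2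
    (α k * α l).ne_zero)) h1]
  simp only [Polynomial.eval_add, Polynomial.eval_mul, Polynomial.eval_C, Polynomial.eval_X]
  ring

lemma IsWittForm.coeff_one [IsDomain R] (hg : IsWittCocycle g) (h : IsWittForm g α b)
    (k l : Fin n → ℤ) (i j : Fin n) :
    X j * (genericShift l (b k i)).coeff 1 - X i * (genericShift k (b l j)).coeff 1 +
      (k j : MvPolynomial (Fin n) R) * b k i - (l i : MvPolynomial (Fin n) R) * b l j =
      (k j : MvPolynomial (Fin n) R) * b (k + l) i -
        (l i : MvPolynomial (Fin n) R) * b (k + l) j := by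
  have h1 := congrArg (fun p => Polynomial.coeff p (0 + 1)) (h.relPoly_eq hg k l i j)
  simp only [relPoly, Polynomial.coeff_add, Polynomial.coeff_sub, Polynomial.coeff_C_mul,
    Polynomial.coeff_mul_X, Polynomial.coeff_C_succ, coeff_zero_genericShift,
    Polynomial.coeff_C_zero] at h1
  linear_combination h1

lemma IsWittForm.coeff_add_two [IsDomain R] (hg : IsWittCocycle g) (h : IsWittForm g α b)
    (k l : Fin n → ℤ) (i j : Fin n) (r : ℕ) :
    X j * (genericShift l (b k i)).coeff (r + 2) - X i * (genericShift k (b l j)).coeff (r + 2) +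
      b k i * (genericShift k (b l j)).coeff (r + 1) -
      b l j * (genericShift l (b k i)).coeff (r + 1) = 0 := by
  have h1 := congrArg (fun p => Polynomial.coeff p (r + 1 + 1)) (h.relPoly_eq hg k l i j)
  simp only [relPoly, Polynomial.coeff_add, Polynomial.coeff_sub, Polynomial.coeff_C_mul,
    Polynomial.coeff_mul_X, Polynomial.coeff_C_succ] at h1
  linear_combination h1

/-- Replacing `l` by `2l` scales the terms with `genericShift l` in `coeff_add_two` by `2 ^ (r + 2)`
and the terms with `genericShift k` only by 2. Hence the two groups vanish separately. -/
lemma IsWittForm.coeff_recursion [IsDomain R] (hg : IsWittCocycle g) (h : IsWittForm g α b)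
    (k l : Fin n → ℤ) (i j : Fin n) (r : ℕ) :
    X i * (genericShift k (b l j)).coeff (r + 2) =
      b k i * (genericShift k (b l j)).coeff (r + 1) := by
  have : CharZero R := charZero_of_injective_algebraMap (algebraMap ℂ R).injective
  have h1 := h.coeff_add_two hg k l i j r
  have h2 := h.coeff_add_two hg k (2 • l) i j r
  have h3 : b (2 • l) j = 2 * b l j := by
    have := h.zsmul 2 l j
    rwa [ofNat_zsmul, Int.cast_ofNat] at this
  have h4 : genericShift k (2 : MvPolynomial (Fin n) R) = Polynomial.C 2 := map_ofNat _ 2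
  simp only [genericShift_nsmul, h3, map_mul, h4, Polynomial.comp_C_mul_X_coeff,
    Polynomial.coeff_C_mul, Nat.cast_ofNat] at h2
  have h5 : ((2 : MvPolynomial (Fin n) R) ^ (r + 2) - 2) ≠ 0 := by
    have : (2 : ℕ) ^ (r + 2) - 2 ≠ 0 := by
      have : (2 : ℕ) ^ (r + 2) = 4 * 2 ^ r := by ring
      have : 0 < 2 ^ r := by positivity
      omega
    have h6 : (((2 : ℤ) ^ (r + 2) - 2 : ℤ) : MvPolynomial (Fin n) R) ≠ 0 := by
      rw [Int.cast_ne_zero]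
      have : (2 : ℤ) ^ (r + 2) = 4 * 2 ^ r := by ring
      have : (0 : ℤ) < 2 ^ r := by positivity
      omega
    simpa using h6
  have h6 : X j * (genericShift l (b k i)).coeff (r + 2) -
      b l j * (genericShift l (b k i)).coeff (r + 1) = 0 := by
    refine (mul_eq_zero.1 ?_).resolve_left h5
    linear_combination h2 - 2 * h1
  linear_combination -h1 + h6

lemma IsWittForm.shift_eq [IsDomain R] (h : IsWittForm g α b) (k : Fin n → ℤ) (i : Fin n) :
    shift k (b k i) = b k i := by
  have := eval_genericShift k 1 (b k i)
  rw [h.inv, Polynomial.eval_C, one_smul] at this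
  exact this.symm

/-- If the degree in `T` is positive, `coeff_recursion` just above the top coefficient forces `b k =
0`. With `b k = 0` the same recursion excludes degree at least 2. Degree 1 remains, with top
coefficient `e`, and is excluded by a shift argument. -/
lemma IsWittForm.natDegree_eq_zero [IsDomain R] (hg : IsWittCocycle g) (h : IsWittForm g α b)
    (k l : Fin n → ℤ) (j : Fin n) : (genericShift k (b l j)).natDegree = 0 := by
  have : CharZero R := charZero_of_injective_algebraMap (algebraMap ℂ R).injective
  by_contra hd
  have hk : k ≠ 0 := by
    rintro rfl
    apply hd
    have := genericShift_nsmul 0 (0 : Fin n → ℤ) (b l j)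
    rw [smul_zero] at this
    rw [this]
    simp
  obtain ⟨i, hi⟩ := Function.ne_iff.1 hk
  have hlc : (genericShift k (b l j)).coeff (genericShift k (b l j)).natDegree ≠ 0 := by
    rw [Polynomial.coeff_natDegree, Polynomial.leadingCoeff_ne_zero]
    rintro h0
    rw [h0] at hd
    simp at hd
  obtain ⟨r, hr⟩ := Nat.exists_eq_succ_of_ne_zero hd
  have hbk : ∀ i, b k i = 0 := by
    intro i
    have h1 := h.coeff_recursion hg k l i j r
    rw [Polynomial.coeff_eq_zero_of_natDegree_lt (n := r + 2) (by omega), mul_zero] at h1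
    rw [hr] at hlc
    exact (mul_eq_zero.1 h1.symm).resolve_right hlc
  have hr0 : r = 0 := by
    by_contra hr0
    obtain ⟨s, rfl⟩ := Nat.exists_eq_succ_of_ne_zero hr0
    have h1 := h.coeff_recursion hg k l i j s
    rw [hbk, zero_mul] at h1
    rw [hr] at hlc
    exact (mul_eq_zero.1 h1).elim (X_ne_zero i) hlc
  subst hr0
  set e := (genericShift k (b l j)).coeff 1 with he
  have hE : genericShift k (b l j) = Polynomial.C e * Polynomial.X + Polynomial.C (b l j) := by
    conv_lhs => rw [Polynomial.eq_X_add_C_of_natDegree_le_one hr.le, coeff_zero_genericShift]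
  have hs1 : shift k (b l j) = e + b l j := by
    have := eval_genericShift k 1 (b l j)
    rw [hE, one_smul] at this
    simpa using this.symm
  have hs2 : shift k e = e := by
    have h2 := eval_genericShift k 2 (b l j)
    rw [hE, two_smul, ← shift_shift, hs1, map_add, hs1] at h2
    simp at h2
    linear_combination -h2
  have hs3 : shift l e = e := by
    have h2 : shift l (shift k (b l j)) = shift l (e + b l j) := by rw [hs1]
    rw [shift_comm, h.shift_eq, hs1, map_add, h.shift_eq] at h2
    linear_combination -h2
  -- The right side of `coeff_one` is invariant under the shift by `k + l`, while the left side
  -- changes by `kᵢ e`.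
  have h1 := h.coeff_one hg k l i j
  rw [hbk, map_zero, ← he] at h1
  have h2 := congrArg (shift (k + l)) h1
  simp only [map_add, map_sub, map_mul, shift_X, map_intCast, h.shift_eq, Polynomial.coeff_zero,
    map_zero, mul_zero] at h2
  rw [← shift_shift, ← shift_shift, hs3, hs2, h.shift_eq, hs1] at h2
  have h3 : (k i : MvPolynomial (Fin n) R) * e = 0 := by
    simp only [Pi.add_apply, Int.cast_add, Polynomial.coeff_zero, mul_zero] at h1 h2
    linear_combination h2 - h1
  rw [hr] at hlc
  refine (mul_eq_zero.1 h3).elim ?_ hlc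
  exact_mod_cast hi

/-- The `b_{k,i}` are constant. -/
lemma IsWittForm.exists_C [IsDomain R] (hg : IsWittCocycle g) (h : IsWittForm g α b)
    (l : Fin n → ℤ) (j : Fin n) : ∃ r, b l j = C r := by
  have : CharZero R := charZero_of_injective_algebraMap (algebraMap ℂ R).injective
  refine exists_eq_C_of_shift_eq fun k => ?_
  have h1 := eval_genericShift k 1 (b l j)
  rw [Polynomial.eq_C_of_natDegree_eq_zero (h.natDegree_eq_zero hg k l j), Polynomial.eval_C,
    coeff_zero_genericShift, one_smul] at h1
  exact h1.symm

theorem IsWittCocycle.classification [IsDomain R]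
    (hR : ∀ u : Rˣ, ∃ c : ℂ, algebraMap ℂ R c = u) (hg : IsWittCocycle g) :
    ∃ (Λ : Fin n → ℂˣ) (a : R), ∀ k i, g k i = ((∏ j, Λ j ^ k j : ℂˣ) : ℂ) •
      (X i - C ((k i : R) * (a + 1))) := by
  have : CharZero R := charZero_of_injective_algebraMap (algebraMap ℂ R).injective
  obtain ⟨α, b, h⟩ := hg.exists_form hR
  have hα : ∀ k, α k = ∏ j, α (Pi.single j 1) ^ k j := by
    have hα0 : α 0 = 1 := by simpa using h.unit_zsmul 0 0
    let φ : (Fin n → ℤ) →+ Additive ℂˣ :=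
      { toFun := fun k => Additive.ofMul (α k)
        map_zero' := congrArg Additive.ofMul hα0
        map_add' := fun k l => congrArg Additive.ofMul (h.unit_add hg k l) }
    intro k
    have h1 : φ k = ∑ j, k j • φ (Pi.single j 1) := by
      conv_lhs => rw [← Finset.univ_sum_single k, map_sum]
      refine Finset.sum_congr rfl fun j _ => ?_
      rw [← map_zsmul, ← Pi.single_smul, smul_eq_mul, mul_one]
    exact congrArg Additive.toMul h1
  choose β hβ using h.exists_C hg
  have hrel : ∀ k l i j, (k j : R) * β k i - l i * β l j =
      k j * β (k + l) i - l i * β (k + l) j := by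
    intro k l i j
    have h1 := h.coeff_one hg k l i j
    simp only [hβ, genericShift_C, Polynomial.coeff_C_succ, mul_zero, sub_zero, zero_add] at h1
    refine C_injective (Fin n) R ?_
    simpa using h1
  have hβsmul : ∀ (m : ℤ) k i, β (m • k) i = m * β k i := by
    intro m k i
    have h1 := h.zsmul m k i
    rw [hβ, hβ] at h1
    refine C_injective (Fin n) R ?_
    rw [h1]
    simp
  have hβ0 : ∀ i, β 0 i = 0 := fun i => by simpa using hβsmul 0 0 i
  have hβl : ∀ l j, β l j = l j * β (Pi.single j 1) j := by
    intro l j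
    by_cases hl : l = 0
    · simp [hl, hβ0]
    · obtain ⟨i, hi⟩ := Function.ne_iff.1 hl
      -- The first index has zero `j`-th coordinate, so both terms with the factor `kⱼ` drop out,
      -- and the sum of the indices is `lⱼ eⱼ`.
      have h1 := hrel (l j • Pi.single j 1 - l) l i j
      rw [sub_add_cancel, hβsmul (l j) _ j] at h1
      have hi' : (l i : R) ≠ 0 := by exact_mod_cast hi
      refine mul_left_cancel₀ hi' ?_
      simp only [Pi.sub_apply, Pi.smul_apply, Pi.single_eq_same, smul_eq_mul, mul_one, sub_self,
        Int.cast_zero, zero_mul, zero_sub, neg_inj] at h1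
      exact h1
  have hβij : ∀ i j, β (Pi.single i 1) i = β (Pi.single j 1) j := by
    intro i j
    by_cases hij : i = j
    · rw [hij]
    · have h1 := hrel (Pi.single j 1) (Pi.single i 1) i j
      rw [hβl (Pi.single j 1) i, hβl (Pi.single i 1) j, hβl (_ + _) i, hβl (_ + _) j] at h1
      simpa [hij, Ne.symm hij, sub_eq_zero] using h1.symm
  obtain ⟨a, ha⟩ : ∃ a : R, ∀ i, β (Pi.single i 1) i = a + 1 := by
    rcases isEmpty_or_nonempty (Fin n) with hn | ⟨⟨i⟩⟩
    · exact ⟨0, fun i => hn.elim i⟩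
    · exact ⟨β (Pi.single i 1) i - 1, fun j => by rw [hβij j i]; ring⟩
  refine ⟨fun j => α (Pi.single j 1), a, fun k i => ?_⟩
  rw [h.eq, hβ, hβl, ha, ← hα, Algebra.smul_def]

end Form

end WittAlgebra

end

noncomputable section

namespace WittAlgebra

attribute [local instance 100] LieRing.ofAssociativeRing

open UniversalEnvelopingAlgebra MvPolynomial

/-! ### `U(Z)` as a polynomial ring: no zero divisors, and only scalar units -/

section Abelian

variable (Z : Type*) [LieRing Z] [LieAlgebra ℂ Z] [IsLieAbelian Z]

/-- The enveloping algebra of an abelian Lie algebra is a polynomial algebra. -/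
def abelianEquiv {I : Type*} (B : Module.Basis I ℂ Z) : U Z ≃ₐ[ℂ] MvPolynomial I ℂ :=
  AlgEquiv.ofAlgHom
    (UniversalEnvelopingAlgebra.lift ℂ
      ({ B.constr ℂ (X : I → MvPolynomial I ℂ) with
        map_lie' := fun {x y} => by
          rw [trivial_lie_zero, LieRing.of_associative_ring_bracket, mul_comm, sub_self]
          exact map_zero (B.constr ℂ (X : I → MvPolynomial I ℂ)) } :
        Z →ₗ⁅ℂ⁆ MvPolynomial I ℂ))
    (aeval fun i => (UniversalEnvelopingAlgebra.ι ℂ (B i) : U Z))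
    (algHom_ext fun i => by
      rw [AlgHom.comp_apply, aeval_X, UniversalEnvelopingAlgebra.lift_ι_apply]
      exact B.constr_basis ℂ _ i)
    (UniversalEnvelopingAlgebra.hom_ext ℂ (LieHom.ext fun x => by
      have : (aeval fun i => (UniversalEnvelopingAlgebra.ι ℂ (B i) : U Z)).toLinearMap ∘ₗ
          B.constr ℂ (X : I → MvPolynomial I ℂ) =
          (UniversalEnvelopingAlgebra.ι ℂ : Z →ₗ⁅ℂ⁆ U Z).toLinearMap :=
        B.ext fun i => by simp
      simp only [LieHom.comp_apply, AlgHom.coe_toLieHom, AlgHom.comp_apply,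
        UniversalEnvelopingAlgebra.lift_ι_apply]
      exact LinearMap.congr_fun this x))

instance : IsDomain (U Z) :=
  (abelianEquiv Z (Module.Free.chooseBasis ℂ Z)).toMulEquiv.isDomain _

lemma exists_algebraMap_eq_unit_U (u : (U Z)ˣ) : ∃ c : ℂ, algebraMap ℂ (U Z) c = u := by
  let e := abelianEquiv Z (Module.Free.chooseBasis ℂ Z)
  obtain ⟨c, -, hc⟩ := isUnit_iff_eq_C_of_isReduced.1 (u.isUnit.map e)
  refine ⟨c, e.injective ?_⟩
  rw [hc, AlgEquiv.commutes]
  rfl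

end Abelian

/-! ### Identifying `U(D ⊕ Z)` with `U(Z)[d₁, …, dₙ]` -/

section Restriction

variable (n : ℕ) (Z : Type*) [LieRing Z] [LieAlgebra ℂ Z]

lemma d_mem_D (i : Fin n) : d i ∈ D n := Submodule.subset_span ⟨i, rfl⟩

lemma exists_apply_mono_of_mem_D {x : Witt n} (hx : x ∈ D n) (k : Fin n → ℤ) :
    ∃ c : ℂ, x (mono k) = c • mono k := by
  have hx' : x ∈ Submodule.span ℂ (Set.range (d : Fin n → Witt n)) := hx
  clear hx
  induction hx' using Submodule.span_induction with
  | mem x hx =>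
    obtain ⟨i, rfl⟩ := hx
    exact ⟨_, d_mono i k⟩
  | zero => exact ⟨0, by simp⟩
  | add x y _ _ hx hy =>
    obtain ⟨a, ha⟩ := hx
    obtain ⟨b, hb⟩ := hy
    exact ⟨a + b, by rw [Derivation.add_apply, ha, hb, add_smul]⟩
  | smul c x _ hx =>
    obtain ⟨a, ha⟩ := hx
    exact ⟨c * a, by rw [Derivation.smul_apply, ha, mul_smul]⟩

lemma lie_eq_zero_of_mem_D {x y : Witt n} (hx : x ∈ D n) (hy : y ∈ D n) : ⁅x, y⁆ = 0 := by
  refine deriv_ext fun k => ?_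
  obtain ⟨a, ha⟩ := exists_apply_mono_of_mem_D n hx k
  obtain ⟨b, hb⟩ := exists_apply_mono_of_mem_D n hy k
  rw [Derivation.commutator_apply, ha, hb, Derivation.map_smul, Derivation.map_smul, ha, hb,
    smul_comm, sub_self, Derivation.zero_apply]

instance [IsLieAbelian Z] : IsLieAbelian (DZ n Z) :=
  ⟨fun x y => Subtype.ext (Prod.ext (lie_eq_zero_of_mem_D n x.2 y.2) (trivial_lie_zero Z Z _ _))⟩

/-- The coefficient of `dᵢ` in a derivation. -/
def dCoeff (i : Fin n) : Witt n →ₗ[ℂ] ℂ :=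
  ofMono (fun k => if k = 0 then 1 else 0) ∘ₗ coef i

lemma dCoeff_d (i j : Fin n) : dCoeff n i (d j) = if i = j then 1 else 0 := by
  have h := coef_smul_d i j (mono 0)
  rw [mono_zero, one_smul] at h
  rw [dCoeff, LinearMap.comp_apply, h]
  split_ifs
  · rw [← mono_zero, ofMono_mono, if_pos rfl]
  · rw [map_zero]

lemma sum_dCoeff {x : Witt n} (hx : x ∈ D n) : ∑ i, dCoeff n i x • d i = x := by
  have : Set.EqOn (∑ i, (dCoeff n i).smulRight (d i) : Witt n →ₗ[ℂ] Witt n)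
      (LinearMap.id : Witt n →ₗ[ℂ] Witt n)
      (Submodule.span ℂ (Set.range (d : Fin n → Witt n)) : Set (Witt n)) := by
    refine LinearMap.eqOn_span ?_
    rintro _ ⟨j, rfl⟩
    simp [dCoeff_d]
  simpa using this hx

/-- The elements `(dᵢ, 0)` of `D ⊕ Z`. -/
def dDZ (i : Fin n) : DZ n Z := ⟨(d i, 0), d_mem_D n i⟩

/-- The inclusion `Z → D ⊕ Z`. -/
def inrDZ : Z →ₗ⁅ℂ⁆ DZ n Z where
  toFun z := ⟨(0, z), (D n).zero_mem⟩
  map_add' x y := Subtype.ext (by simp)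
  map_smul' c x := Subtype.ext (by simp)
  map_lie' := Subtype.ext (by simp)

variable [IsLieAbelian Z]

/-- The linear map `Wₙ ⊕ Z → U(Z)[d₁, …, dₙ]` sending `∑ᵢ fᵢ dᵢ + z` to `∑ᵢ fᵢ(0) dᵢ + z`, where
`fᵢ(0)` is the constant coefficient of `fᵢ`. -/
def polyLin : Witt n × Z →ₗ[ℂ] MvPolynomial (Fin n) (U Z) :=
  ∑ i, ((dCoeff n i).smulRight (X i)) ∘ₗ LinearMap.fst ℂ (Witt n) Z +
    (IsScalarTower.toAlgHom ℂ (U Z) (MvPolynomial (Fin n) (U Z))).toLinearMap ∘ₗ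
      (UniversalEnvelopingAlgebra.ι ℂ : Z →ₗ⁅ℂ⁆ U Z).toLinearMap ∘ₗ LinearMap.snd ℂ (Witt n) Z

lemma polyLin_apply (x : Witt n × Z) : polyLin n Z x =
    ∑ i, dCoeff n i x.1 • X i + C (UniversalEnvelopingAlgebra.ι ℂ x.2) := by
  simp only [polyLin, LinearMap.add_apply, LinearMap.sum_apply]
  rfl

/-- The map `U(D ⊕ Z) → U(Z)[d₁, …, dₙ]`. -/
def toPoly : U (DZ n Z) →ₐ[ℂ] MvPolynomial (Fin n) (U Z) :=
  UniversalEnvelopingAlgebra.lift ℂ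
    { polyLin n Z ∘ₗ (DZ n Z).incl.toLinearMap with
      map_lie' := fun {x y} => by
        rw [trivial_lie_zero, LieRing.of_associative_ring_bracket, mul_comm, sub_self]
        exact map_zero (polyLin n Z ∘ₗ (DZ n Z).incl.toLinearMap) }

lemma toPoly_ι (x : DZ n Z) : toPoly n Z (UniversalEnvelopingAlgebra.ι ℂ x) =
    ∑ i, dCoeff n i x.1.1 • X i + C (UniversalEnvelopingAlgebra.ι ℂ x.1.2) := by
  rw [toPoly, UniversalEnvelopingAlgebra.lift_ι_apply]
  exact polyLin_apply n Z x.1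

/-- The map `U(Z) → U(D ⊕ Z)`. -/
def inrU : U Z →ₐ[ℂ] U (DZ n Z) :=
  UniversalEnvelopingAlgebra.lift ℂ ((UniversalEnvelopingAlgebra.ι ℂ).comp (inrDZ n Z))

/-- The map `U(Z)[d₁, …, dₙ] → U(D ⊕ Z)`. -/
def ofPoly : MvPolynomial (Fin n) (U Z) →ₐ[ℂ] U (DZ n Z) :=
  { eval₂Hom (inrU n Z).toRingHom (fun i => UniversalEnvelopingAlgebra.ι ℂ (dDZ n Z i)) with
    commutes' := fun c => by
      show eval₂Hom _ _ (C (algebraMap ℂ (U Z) c)) = _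
      rw [eval₂Hom_C]
      exact (inrU n Z).commutes c }

lemma ofPoly_C (u : U Z) : ofPoly n Z (C u) = inrU n Z u := eval₂Hom_C _ _ _

lemma ofPoly_X (i : Fin n) :
    ofPoly n Z (X i) = UniversalEnvelopingAlgebra.ι ℂ (dDZ n Z i) := eval₂Hom_X' _ _ _

lemma toPoly_inrU (u : U Z) : toPoly n Z (inrU n Z u) = C u := by
  have : (toPoly n Z).comp (inrU n Z) =
      IsScalarTower.toAlgHom ℂ (U Z) (MvPolynomial (Fin n) (U Z)) := by
    refine UniversalEnvelopingAlgebra.hom_ext ℂ (LieHom.ext fun z => ?_)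
    show toPoly n Z (inrU n Z (UniversalEnvelopingAlgebra.ι ℂ z)) =
      C (UniversalEnvelopingAlgebra.ι ℂ z)
    rw [inrU, UniversalEnvelopingAlgebra.lift_ι_apply, LieHom.comp_apply, toPoly_ι]
    simp [inrDZ]
  exact DFunLike.congr_fun this u

lemma toPoly_d (i : Fin n) : toPoly n Z (UniversalEnvelopingAlgebra.ι ℂ (dDZ n Z i)) = X i := by
  rw [toPoly_ι]
  simp [dDZ, dCoeff_d]

/-- `U(D ⊕ Z)` is the polynomial algebra `U(Z)[d₁, …, dₙ]`. -/
def polyEquiv : U (DZ n Z) ≃ₐ[ℂ] MvPolynomial (Fin n) (U Z) :=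
  AlgEquiv.ofAlgHom (toPoly n Z) (ofPoly n Z)
    (by
      refine AlgHom.coe_ringHom_injective (MvPolynomial.ringHom_ext (fun u => ?_) fun i => ?_)
      · show toPoly n Z (ofPoly n Z (C u)) = C u
        rw [ofPoly_C, toPoly_inrU]
      · show toPoly n Z (ofPoly n Z (X i)) = X i
        rw [ofPoly_X, toPoly_d])
    (by
      refine UniversalEnvelopingAlgebra.hom_ext ℂ (LieHom.ext fun x => ?_)
      show ofPoly n Z (toPoly n Z (UniversalEnvelopingAlgebra.ι ℂ x)) =
        UniversalEnvelopingAlgebra.ι ℂ x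
      rw [toPoly_ι, map_add, map_sum, ofPoly_C, inrU, UniversalEnvelopingAlgebra.lift_ι_apply,
        LieHom.comp_apply]
      simp only [map_smul, ofPoly_X]
      simp only [← map_smul, ← map_sum, ← map_add]
      congr 1
      refine Subtype.ext (Prod.ext ?_ ?_)
      · simpa [dDZ, inrDZ, Prod.fst_sum] using sum_dCoeff n x.2
      · simp [dDZ, inrDZ, Prod.snd_sum])

end Restriction

end WittAlgebra

end

noncomputable section

namespace WittAlgebra

attribute [local instance 100] LieRing.ofAssociativeRing

open MvPolynomial

/-! ### Passing between modules and cocycles -/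

section Transport

variable {n : ℕ} {Z : Type*} [LieRing Z] [LieAlgebra ℂ Z]

/-- A derivation as an element of `U(Wₙ ⊕ Z)`. -/
def wittU (δ : Witt n) : U (Witt n × Z) := UniversalEnvelopingAlgebra.ι ℂ (δ, 0)

variable (n) in
/-- The map `U(Z) → U(Wₙ ⊕ Z)`. -/
def centralU : U Z →ₐ[ℂ] U (Witt n × Z) :=
  UniversalEnvelopingAlgebra.lift ℂ
    ((UniversalEnvelopingAlgebra.ι ℂ).comp (LieHom.inr ℂ (Witt n) Z))

lemma centralU_ι (z : Z) : centralU n (UniversalEnvelopingAlgebra.ι ℂ z : U Z) =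
    UniversalEnvelopingAlgebra.ι ℂ ((0, z) : Witt n × Z) := by
  rw [centralU, UniversalEnvelopingAlgebra.lift_ι_apply]
  rfl

lemma ι_mul_sub {L : Type*} [LieRing L] [LieAlgebra ℂ L] (x y : L) :
    (UniversalEnvelopingAlgebra.ι ℂ x : U L) * UniversalEnvelopingAlgebra.ι ℂ y -
      UniversalEnvelopingAlgebra.ι ℂ y * UniversalEnvelopingAlgebra.ι ℂ x =
    UniversalEnvelopingAlgebra.ι ℂ ⁅x, y⁆ := by
  rw [LieHom.map_lie, LieRing.of_associative_ring_bracket]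

lemma wittU_add (δ ε : Witt n) : (wittU (δ + ε) : U (Witt n × Z)) = wittU δ + wittU ε := by
  rw [wittU, wittU, wittU, ← map_add, Prod.mk_add_mk, add_zero]

lemma wittU_smul (c : ℂ) (δ : Witt n) :
    (wittU (c • δ) : U (Witt n × Z)) = algebraMap ℂ _ c * wittU δ := by
  rw [wittU, wittU, ← Algebra.smul_def, ← map_smul, Prod.smul_mk, smul_zero]

lemma wittU_sub (δ ε : Witt n) : (wittU (δ - ε) : U (Witt n × Z)) = wittU δ - wittU ε := by
  rw [wittU, wittU, wittU, ← map_sub, Prod.mk_sub_mk, sub_zero]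

lemma wittU_mul_sub (δ ε : Witt n) :
    (wittU δ : U (Witt n × Z)) * wittU ε - wittU ε * wittU δ = wittU ⁅δ, ε⁆ := by
  rw [wittU, wittU, ι_mul_sub, wittU]
  congr 1
  exact Prod.ext rfl (lie_self 0)

lemma wittU_mul_centralU (δ : Witt n) (u : U Z) :
    wittU δ * centralU n u = centralU n u * wittU δ := by
  have h : (Subalgebra.centralizer ℂ {(wittU δ : U (Witt n × Z))}).comap (centralU n) = ⊤ := by
    refine subalgebra_eq_top _ fun z => ?_
    rw [Subalgebra.mem_comap, Subalgebra.mem_centralizer_iff]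
    rintro _ rfl
    rw [centralU_ι, ← sub_eq_zero, wittU, ι_mul_sub]
    have : ⁅((δ, 0) : Witt n × Z), ((0, z) : Witt n × Z)⁆ = 0 :=
      Prod.ext (lie_zero δ) (zero_lie z)
    rw [this, map_zero]
  have hu : u ∈ (Subalgebra.centralizer ℂ {(wittU δ : U (Witt n × Z))}).comap (centralU n) :=
    h ▸ Algebra.mem_top
  exact (Subalgebra.mem_centralizer_iff ℂ).1 hu _ rfl

variable [IsLieAbelian Z] {M : Type*} [AddCommGroup M] [Module (U (Witt n × Z)) M]

/-- An additive identification of `M` with `U(Z)[d₁, …, dₙ]` such that each `dᵢ` acts as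
multiplication by `dᵢ`, and `U(Z)` acts by multiplication. -/
structure IsPolyModel (Φ : M ≃+ MvPolynomial (Fin n) (U Z)) : Prop where
  d_smul : ∀ i m, Φ ((wittU (d i) : U (Witt n × Z)) • m) = X i * Φ m
  central_smul : ∀ u m, Φ (centralU n u • m) = C u * Φ m

/-- Restricting to a free module of rank one over `U(D ⊕ Z)` gives a polynomial model. -/
lemma exists_isPolyModel (hM : IsFreeOfRankOne (DZ n Z) M) :
    ∃ Φ : M ≃+ MvPolynomial (Fin n) (U Z), IsPolyModel Φ := by
  let _ : Module (U (DZ n Z)) M := Module.compHom M (resHom (DZ n Z)).toRingHom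
  obtain ⟨e⟩ : Nonempty (M ≃ₗ[U (DZ n Z)] U (DZ n Z)) := hM
  have hres : ∀ (u : U (DZ n Z)) (m : M), polyEquiv n Z (e (resHom (DZ n Z) u • m)) =
      polyEquiv n Z u * polyEquiv n Z (e m) := fun u m => by
    have : e (resHom (DZ n Z) u • m) = u * e m := e.map_smul u m
    rw [this, map_mul]
  refine ⟨e.toAddEquiv.trans (polyEquiv n Z).toAddEquiv, fun i m => ?_, fun u m => ?_⟩
  · have h := hres (UniversalEnvelopingAlgebra.ι ℂ (dDZ n Z i)) m
    have h1 : polyEquiv n Z (UniversalEnvelopingAlgebra.ι ℂ (dDZ n Z i)) = X i := toPoly_d n Z i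
    rw [h1, resHom, UniversalEnvelopingAlgebra.lift_ι_apply] at h
    exact h
  · have h := hres (inrU n Z u) m
    have h1 : polyEquiv n Z (inrU n Z u) = C u := toPoly_inrU n Z u
    have h2 : (resHom (DZ n Z)).comp (inrU n Z) = centralU n := by
      refine UniversalEnvelopingAlgebra.hom_ext ℂ (LieHom.ext fun z => ?_)
      show resHom (DZ n Z) (inrU n Z (UniversalEnvelopingAlgebra.ι ℂ z)) =
        centralU n (UniversalEnvelopingAlgebra.ι ℂ z)
      rw [centralU_ι, inrU, UniversalEnvelopingAlgebra.lift_ι_apply, LieHom.comp_apply, resHom,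
        UniversalEnvelopingAlgebra.lift_ι_apply]
      rfl
    have h3 : resHom (DZ n Z) (inrU n Z u) = centralU n u := DFunLike.congr_fun h2 u
    rw [h1, h3] at h
    exact h

variable {Φ : M ≃+ MvPolynomial (Fin n) (U Z)}

/-- `Φ` is only additive, as `M` has no separate complex structure; linearity over `ℂ` is recovered
from the scalars inside `U Z`. -/
lemma IsPolyModel.algebraMap_smul (hΦ : IsPolyModel Φ) (c : ℂ) (m : M) :
    Φ (algebraMap ℂ (U (Witt n × Z)) c • m) = c • Φ m := by
  rw [← (centralU n (Z := Z)).commutes c, hΦ.central_smul, Algebra.smul_def]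
  rfl

/-- The image of `1` under `t^k dᵢ`. -/
def IsPolyModel.cocycle (_ : IsPolyModel Φ) (k : Fin n → ℤ) (i : Fin n) :
    MvPolynomial (Fin n) (U Z) :=
  Φ ((wittU (mono k • d i) : U (Witt n × Z)) • Φ.symm 1)

/-- Moving `t^k dᵢ` past `dⱼ` replaces `Xⱼ` by `Xⱼ - kⱼ`, and it commutes with `U Z`; so the action
is determined by the image of `1`. -/
lemma IsPolyModel.mono_smul (hΦ : IsPolyModel Φ) (k : Fin n → ℤ) (i : Fin n) (m : M) :
    Φ ((wittU (mono k • d i) : U (Witt n × Z)) • m) = shift k (Φ m) * hΦ.cocycle k i := by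
  obtain ⟨f, rfl⟩ := Φ.symm.surjective m
  rw [Φ.apply_symm_apply]
  induction f using MvPolynomial.induction_on with
  | C r =>
    have h : Φ.symm (C r) = centralU n r • Φ.symm 1 := Φ.injective (by
      rw [hΦ.central_smul, Φ.apply_symm_apply, Φ.apply_symm_apply, mul_one])
    rw [h, ← mul_smul, wittU_mul_centralU, mul_smul, hΦ.central_smul, shift_C]
    rfl
  | add p q hp hq => rw [map_add, smul_add, map_add, hp, hq, map_add, add_mul]
  | mul_X p j hp =>
    have h : Φ.symm (p * X j) = (wittU (d j) : U (Witt n × Z)) • Φ.symm p := Φ.injective (by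
      rw [hΦ.d_smul, Φ.apply_symm_apply, Φ.apply_symm_apply, mul_comm])
    have hb : ⁅(d j : Witt n), mono k • d i⁆ = (k j : ℂ) • (mono k • d i) := by
      have := bracket_d (0 : Fin n → ℤ) k j i
      simpa [mono_zero] using this
    have hc : (wittU (mono k • d i) : U (Witt n × Z)) * wittU (d j) =
        wittU (d j) * wittU (mono k • d i) -
          algebraMap ℂ _ (k j : ℂ) * wittU (mono k • d i) := by
      rw [← wittU_smul, ← hb, ← wittU_mul_sub]
      abel
    rw [h, ← mul_smul, hc, sub_smul, map_sub, mul_smul, mul_smul, hΦ.d_smul,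
      hΦ.algebraMap_smul, hp, map_mul, shift_X, Algebra.smul_def, map_intCast]
    ring

lemma IsPolyModel.isWittCocycle (hΦ : IsPolyModel Φ) : IsWittCocycle hΦ.cocycle where
  zero i := by
    rw [IsPolyModel.cocycle, mono_zero, one_smul, hΦ.d_smul, Φ.apply_symm_apply, mul_one]
  rel k l i j := by
    have h := congrArg (fun u : U (Witt n × Z) => Φ (u • Φ.symm 1))
      (wittU_mul_sub (Z := Z) (mono k • d i) (mono l • d j))
    simp only [sub_smul, mul_smul, map_sub, hΦ.mono_smul, Φ.apply_symm_apply, map_one,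
      one_mul] at h
    rw [bracket_d, wittU_sub, wittU_smul, wittU_smul, sub_smul, map_sub,
      mul_smul, mul_smul, hΦ.algebraMap_smul, hΦ.algebraMap_smul, hΦ.mono_smul, hΦ.mono_smul,
      Φ.apply_symm_apply, map_one, one_mul, one_mul, Algebra.smul_def, Algebra.smul_def,
      map_intCast, map_intCast] at h
    linear_combination h

/-- A polynomial model whose cocycle is that of `Ω(Λ, a)` is isomorphic to `Ω(Λ, a)`. -/
lemma IsPolyModel.nonempty_equiv (hΦ : IsPolyModel Φ) (Λ : Fin n → ℂˣ) (a : U Z)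
    (h : ∀ k i, hΦ.cocycle k i = ((∏ j, Λ j ^ k j : ℂˣ) : ℂ) •
      (X i - C ((k i : U Z) * (a + 1)))) :
    Nonempty (M ≃ₗ[U (Witt n × Z)] Omega Λ a) := by
  have hwitt : ∀ (δ : Witt n) (m : M),
      Φ ((wittU δ : U (Witt n × Z)) • m) = act Λ a δ (Φ m) := by
    intro δ m
    let f : Witt n →ₗ[ℂ] MvPolynomial (Fin n) (U Z) :=
      { toFun := fun δ => Φ ((wittU δ : U (Witt n × Z)) • m)
        map_add' := fun δ ε => by rw [wittU_add, add_smul, map_add]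
        map_smul' := fun c δ => by
          rw [wittU_smul, mul_smul, hΦ.algebraMap_smul, RingHom.id_apply] }
    have hf : f = LinearMap.applyₗ (Φ m) ∘ₗ actLin Λ a := by
      refine witt_hom_ext fun k i => ?_
      show Φ ((wittU (mono k • d i) : U (Witt n × Z)) • m) = actLin Λ a (mono k • d i) (Φ m)
      rw [hΦ.mono_smul, actLin_apply, op_apply, h, mul_smul_comm, mul_comm]
    exact LinearMap.congr_fun hf δ
  -- The elements whose actions on both sides correspond under `Φ` form a subalgebra, so checking
  -- the Lie algebra generators suffices.
  let S : Subalgebra ℂ (U (Witt n × Z)) :=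
    { carrier := {u | ∀ m, Φ (u • m) =
        UniversalEnvelopingAlgebra.lift ℂ (omegaRep Λ a) u (Φ m)}
      mul_mem' := fun {u v} hu hv m => by
        rw [mul_smul, hu, hv, map_mul, Module.End.mul_apply]
      add_mem' := fun {u v} hu hv m => by
        rw [add_smul, map_add, hu, hv, map_add, LinearMap.add_apply]
      algebraMap_mem' := fun c m => by
        rw [hΦ.algebraMap_smul, AlgHom.commutes, Module.algebraMap_end_apply] }
  have hS : S = ⊤ := by
    refine subalgebra_eq_top S ?_
    rintro ⟨δ, z⟩ m
    have hsplit : (UniversalEnvelopingAlgebra.ι ℂ ((δ, z) : Witt n × Z) : U (Witt n × Z)) =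
        wittU δ + centralU n (UniversalEnvelopingAlgebra.ι ℂ z) := by
      rw [centralU_ι, wittU, ← map_add, Prod.mk_add_mk, add_zero, zero_add]
    rw [UniversalEnvelopingAlgebra.lift_ι_apply, hsplit, add_smul, map_add, hwitt,
      hΦ.central_smul]
    rfl
  refine ⟨{ Φ with map_smul' := fun u m => ?_ }⟩
  have hu : u ∈ S := hS ▸ Algebra.mem_top
  exact hu m

end Transport

end WittAlgebra

end

open WittAlgebra in
theorem mainTheorem4 (n : ℕ)
    (Z : Type*) [LieRing Z] [LieAlgebra ℂ Z] [IsLieAbelian Z] [FiniteDimensional ℂ Z]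
    (M : Type*) [AddCommGroup M] [Module (U (Witt n × Z)) M]
    (hM : IsFreeOfRankOne (DZ n Z) M) :
    ∃ (Λ : Fin n → ℂˣ) (a : U Z), Nonempty (M ≃ₗ[U (Witt n × Z)] Omega Λ a) := by
  obtain ⟨Φ, hΦ⟩ := exists_isPolyModel hM
  obtain ⟨Λ, a, h⟩ := hΦ.isWittCocycle.classification (exists_algebraMap_eq_unit_U Z)
  exact ⟨Λ, a, hΦ.nonempty_equiv Λ a h⟩
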